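/- **Setting.** Formulas of unit-free multiplicative linear logic $\mathsf{MLL}^-$ are built from atoms $a$ and $a^\bot$ ($a$ a propositional variable) with the binary connectives $⅋$ and $\otimes$. Negation is defined by $a^{\bot\bot}=a$, $(A\otimes B)^\bot=B^\bot ⅋ A^\bot$, $(A ⅋ B)^\bot=B^\bot\otimes A^\bot$. *Sequent calculus.* Sequents are finite lists of formulas. The rules are: $\mathsf{id}$, with conclusion $\vdash A^\bot,A$ and no premise; $\mathsf{exch}$, from $\vdash\Gamma,A,B,\Delta$ to $\vdash\Gamma,B,A,\Delta$; $⅋$, from $\vdash\Gamma,A,B,\Delta$ to $\vdash\Gamma,A ⅋ B,\Delta$; $\otimes$, from $\vdash\Gamma,A$ and $\vdash B,\Delta$ to $\vdash\Gamma,A\otimes B,\Delta$; $\mathsf{cut}$, from $\vdash\Gamma,A$ and $\vdash A^\bot,\Delta$ to $\vdash\Gamma,\Delta$. *Calculus of structures.* The rules are, for every formula context $S\{\ \}$, written premise $\to$ conclusion: $\mathsf{i}{\downarrow}$: (nothing) $\to A^\bot ⅋ A$ and $S\{B\}\to S\{(A^\bot ⅋ A)\otimes B\}$; $\mathsf{i}{\uparrow}$: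 $A\otimes A^\bot\to$ (nothing) and $S\{B ⅋ (A\otimes A^\bot)\}\to S\{B\}$; commutativity: $S\{A ⅋ B\}\to S\{B ⅋ A\}$ and $S\{A\otimes B\}\to S\{B\otimes A\}$; associativity: $S\{A ⅋ (B ⅋ C)\}\to S\{(A ⅋ B) ⅋ C\}$ and $S\{A\otimes(B\otimes C)\}\to S\{(A\otimes B)\otimes C\}$; switch: $S\{A\otimes(B ⅋ C)\}\to S\{(A\otimes B) ⅋ C\}$. A proof of a formula $F$ is a finite chain of rule instances leading from nothing to $F$. *Nets.* A pre-proof net with conclusions $\Gamma$ consists of the formula trees of $\Gamma$, finitely many (unordered) cuts, i.e. trees $A ⦶ A^\bot$ with a special binary root $⦶$, and a perfect matching (the links) of all leaves of these trees in which only dual atoms are matched. A switching is the graph obtained (with the links as edges) by deleting, for every $⅋$-node, one of the two edges to its children. A proof net is a pre-proof net that is correct: all of its switchings are connected and acyclic. *Translation.* A proof, in either calculus, yields a net by tracing all atom occurrences through it: an instance of $\mathsf{id}$ or $\mathsf{i}{\downarrow}$ links each atom occurrence of $A$ with the corresponding one of $A^\bot$; an instance of $\mathsf{cut}$ or $\mathsf{i}{\uparrow}$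 on $A$, $A^\bot$ becomes a cut $A ⦶ A^\bot$ of the net (the tracing stops there); all other rules only move atom occurrences. **Theorem.** Let $n\ge 1$, let $A_1,\dots,A_n$ be $\mathsf{MLL}^-$ formulas, and let $F$ be $A_1 ⅋ A_2 ⅋ \cdots ⅋ A_n$ with any choice of parentheses. For every sequent calculus proof of $\vdash A_1,\dots,A_n$ there is a proof of $F$ in the calculus of structures that yields the same proof net, and for every proof of $F$ in the calculus of structures there is a sequent calculus proof of $\vdash A_1,\dots,A_n$ that yields the same proof net. Here "the same proof net" means that the nets obtained from the two proofs are correct and that they have the same cuts and the same links, once the conclusions $A_1,\dots,A_n$ of the first are joined by $⅋$-nodes to the single conclusion $F$. -/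

import Mathlib

namespace MLL

universe u

/-! ### Formulas of unit-free multiplicative linear logic -/

/-- Atoms over a set `V` of propositional variables: a variable `a` or its dual `a^⊥`. -/
inductive Atom (V : Type u) : Type u
  | pos (a : V) : Atom V
  | neg (a : V) : Atom V

/-- The dual atom; `a^⊥⊥ = a`. -/
def Atom.dual {V : Type u} : Atom V → Atom V
  | .pos a => .neg a
  | .neg a => .pos a

theorem Atom.dual_dual {V : Type u} (x : Atom V) : x.dual.dual = x := by
  cases x <;> rfl

inductive Formula (V : Type u) : Type u
  | atom (x : Atom V) : Formula V
  | par (A B : Formula V) : Formula V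
  | tens (A B : Formula V) : Formula V

/-- Linear negation; it inverts the order of the arguments. -/
def Formula.dual {V : Type u} : Formula V → Formula V
  | .atom x => .atom x.dual
  | .par A B => .tens B.dual A.dual
  | .tens A B => .par B.dual A.dual

/-! ### Sets of atom occurrences and flows between them -/

/-- A set of (atom) occurrences, each labelled by an atom. -/
structure OccSet (V : Type u) where
  carrier : Type
  lab : carrier → Atom V

/-- No occurrences. -/
abbrev OccSet.empty (V : Type u) : OccSet V := ⟨Empty, Empty.elim⟩

/-- Disjoint union. -/
abbrev OccSet.sum {V : Type u} (X Y : OccSet V) : OccSet V :=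
  ⟨X.carrier ⊕ Y.carrier, Sum.elim X.lab Y.lab⟩

/-- Disjoint union of a family. -/
abbrev OccSet.sigma {V : Type u} {ι : Type} (X : ι → OccSet V) : OccSet V :=
  ⟨(i : ι) × (X i).carrier, fun p => (X p.1).lab p.2⟩

/-- A label-preserving bijection between sets of occurrences: it says how atom occurrences are
traced from one place to another. -/
structure AtomFlow {V : Type u} (X Y : OccSet V) where
  equiv : X.carrier ≃ Y.carrier
  lab_eq : ∀ x, Y.lab (equiv x) = X.lab x

namespace AtomFlow

variable {V : Type u} {X X' Y Y' Z : OccSet V}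

def refl (X : OccSet V) : AtomFlow X X := ⟨Equiv.refl _, fun _ => rfl⟩

def symm (e : AtomFlow X Y) : AtomFlow Y X :=
  ⟨e.equiv.symm, fun y => by rw [← e.lab_eq, Equiv.apply_symm_apply]⟩

def trans (e : AtomFlow X Y) (f : AtomFlow Y Z) : AtomFlow X Z :=
  ⟨e.equiv.trans f.equiv, fun x => by rw [Equiv.trans_apply, f.lab_eq, e.lab_eq]⟩

def sumCongr (e : AtomFlow X X') (f : AtomFlow Y Y') : AtomFlow (X.sum Y) (X'.sum Y') :=
  ⟨Equiv.sumCongr e.equiv f.equiv, by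
    rintro (x | y)
    · exact e.lab_eq x
    · exact f.lab_eq y⟩

def sumComm (X Y : OccSet V) : AtomFlow (X.sum Y) (Y.sum X) :=
  ⟨Equiv.sumComm _ _, by rintro (x | y) <;> rfl⟩

def sumAssoc (X Y Z : OccSet V) : AtomFlow ((X.sum Y).sum Z) (X.sum (Y.sum Z)) :=
  ⟨Equiv.sumAssoc _ _ _, by rintro ((x | y) | z) <;> rfl⟩

def emptySum (X : OccSet V) : AtomFlow ((OccSet.empty V).sum X) X :=
  ⟨Equiv.emptySum Empty X.carrier, by rintro (x | y); exacts [x.elim, rfl]⟩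

def sumEmpty (X : OccSet V) : AtomFlow (X.sum (OccSet.empty V)) X :=
  ⟨Equiv.sumEmpty X.carrier Empty, by rintro (x | y); exacts [rfl, y.elim]⟩

/-- `X + (Y + Z) → Y + (X + Z)`. -/
def leftComm (X Y Z : OccSet V) : AtomFlow (X.sum (Y.sum Z)) (Y.sum (X.sum Z)) :=
  (sumAssoc X Y Z).symm.trans (((sumComm X Y).sumCongr (refl Z)).trans (sumAssoc Y X Z))

/-- `(X + X') + (Y + Y') → (X + Y) + (X' + Y')`. -/
def sumSumComm (X X' Y Y' : OccSet V) :
    AtomFlow ((X.sum X').sum (Y.sum Y')) ((X.sum Y).sum (X'.sum Y')) :=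
  (sumAssoc X X' (Y.sum Y')).trans
    (((refl X).sumCongr (leftComm X' Y Y')).trans (sumAssoc X Y (X'.sum Y')).symm)

/-- A family over a disjoint union of index sets. -/
def sigmaSum {ι κ : Type} {T : Type*} (L : T → OccSet V) (c : ι → T) (d : κ → T) :
    AtomFlow (OccSet.sigma fun i => L (Sum.elim c d i))
      ((OccSet.sigma fun i => L (c i)).sum (OccSet.sigma fun k => L (d k))) :=
  ⟨Equiv.sumSigmaDistrib fun i => (L (Sum.elim c d i)).carrier, by
    rintro ⟨i | k, x⟩ <;> rfl⟩

/-- A family over a one-element index set. -/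
def sigmaUnit (X : OccSet V) : AtomFlow (OccSet.sigma fun _ : Unit => X) X :=
  ⟨Equiv.uniqueSigma fun _ : Unit => X.carrier, by rintro ⟨⟨⟩, x⟩; rfl⟩

/-- Re-indexing of a family. -/
def sigmaReindex {ι κ : Type} (L : ι → OccSet V) (e : κ ≃ ι) :
    AtomFlow (OccSet.sigma L) (OccSet.sigma fun k => L (e k)) :=
  symm ⟨e.sigmaCongrLeft (β := fun i => (L i).carrier), by rintro ⟨k, x⟩; rfl⟩

end AtomFlow

/-- A perfect matching of a set of atom occurrences in which only dual atoms are matched, given as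
the involution that sends each occurrence to its partner. (It has no fixed point, since no atom is
its own dual.) -/
structure Linking {V : Type u} (X : OccSet V) where
  partner : X.carrier → X.carrier
  partner_partner : ∀ x, partner (partner x) = x
  lab_partner : ∀ x, X.lab (partner x) = (X.lab x).dual

/-- Transport of a linking along a flow. -/
def Linking.map {V : Type u} {X Y : OccSet V} (e : AtomFlow X Y) (l : Linking X) : Linking Y where
  partner y := e.equiv (l.partner (e.equiv.symm y))
  partner_partner y := by simp [l.partner_partner]
  lab_partner y := by
    rw [e.lab_eq, l.lab_partner, ← e.lab_eq, Equiv.apply_symm_apply]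

/-- Disjoint union of two linkings. -/
def Linking.sum {V : Type u} {X Y : OccSet V} (l : Linking X) (m : Linking Y) :
    Linking (X.sum Y) where
  partner := Sum.map l.partner m.partner
  partner_partner := by
    rintro (x | y)
    · exact congrArg Sum.inl (l.partner_partner x)
    · exact congrArg Sum.inr (m.partner_partner y)
  lab_partner := by
    rintro (x | y)
    · exact l.lab_partner x
    · exact m.lab_partner y

/-- The linking of the empty set. -/
def Linking.empty (V : Type u) : Linking (OccSet.empty V) where
  partner := id
  partner_partner _ := rfl
  lab_partner x := x.elim

/-! ### Atom occurrences of formulas and sequents -/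

/-- The leaves of the formula tree of `A`, i.e. the atom occurrences in `A`. -/
def Formula.leaf {V : Type u} : Formula V → OccSet V
  | .atom x => ⟨Unit, fun _ => x⟩
  | .par A B => A.leaf.sum B.leaf
  | .tens A B => A.leaf.sum B.leaf

/-- The leaves of a sequent forest. -/
def seqLeaf {V : Type u} : List (Formula V) → OccSet V
  | [] => OccSet.empty V
  | A :: Γ => A.leaf.sum (seqLeaf Γ)

/-- The leaves of a concatenation `Γ, Δ`. -/
def appendFlow {V : Type u} : (Γ Δ : List (Formula V)) →
    AtomFlow (seqLeaf (Γ ++ Δ)) ((seqLeaf Γ).sum (seqLeaf Δ))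
  | [], Δ => (AtomFlow.emptySum (seqLeaf Δ)).symm
  | A :: Γ, Δ => ((AtomFlow.refl A.leaf).sumCongr (appendFlow Γ Δ)).trans
      (AtomFlow.sumAssoc A.leaf (seqLeaf Γ) (seqLeaf Δ)).symm

/-- The leaf of `A^⊥` that corresponds to a given leaf of `A`. -/
def dualLeaf {V : Type u} : (A : Formula V) → A.leaf.carrier ≃ A.dual.leaf.carrier
  | .atom _ => Equiv.refl Unit
  | .par A B => (Equiv.sumCongr (dualLeaf A) (dualLeaf B)).trans (Equiv.sumComm _ _)
  | .tens A B => (Equiv.sumCongr (dualLeaf A) (dualLeaf B)).trans (Equiv.sumComm _ _)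

theorem lab_dualLeaf {V : Type u} : (A : Formula V) → (x : A.leaf.carrier) →
    A.dual.leaf.lab (dualLeaf A x) = (A.leaf.lab x).dual
  | .atom _, _ => rfl
  | .par A _, .inl x => lab_dualLeaf A x
  | .par _ B, .inr x => lab_dualLeaf B x
  | .tens A _, .inl x => lab_dualLeaf A x
  | .tens _ B, .inr x => lab_dualLeaf B x

/-- The linking of `A^⊥, A` given by an identity axiom: each atom occurrence of `A` is linked with
the corresponding one of `A^⊥`. -/
def idLinking {V : Type u} (A : Formula V) : Linking (A.dual.leaf.sum A.leaf) where
  partner := Sum.elim (fun y => Sum.inr ((dualLeaf A).symm y)) (fun x => Sum.inl (dualLeaf A x))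
  partner_partner := by
    rintro (y | x)
    · exact congrArg Sum.inl ((dualLeaf A).apply_symm_apply y)
    · exact congrArg Sum.inr ((dualLeaf A).symm_apply_apply x)
  lab_partner := by
    rintro (y | x)
    · change A.leaf.lab ((dualLeaf A).symm y) = (A.dual.leaf.lab y).dual
      obtain ⟨x, rfl⟩ := (dualLeaf A).surjective y
      rw [Equiv.symm_apply_apply, lab_dualLeaf, Atom.dual_dual]
    · exact lab_dualLeaf A x

/-! ### Pre-proof nets -/

/-- The two formulas of a cut `A ⦶ A^⊥`, as a formula tree. The special connective `⦶` occurs only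
at the root of the trees indexed by `PreNet.Cut`; it is binary and is never switched, so that its
tree is that of `A ⊗ A^⊥`. -/
def cutTree {V : Type u} (A : Formula V) : Formula V := .tens A A.dual

/-- The leaves of a family of cuts. -/
def cutLeaf {V : Type u} {ι : Type} (c : ι → Formula V) : OccSet V :=
  OccSet.sigma fun i => (cutTree (c i)).leaf

/-- A pre-proof net with conclusions `Γ`: the sequent forest `Γ` together with finitely many cuts
`cut i ⦶ (cut i)^⊥`, and a perfect matching of all leaves in which only dual atoms are matched. -/
structure PreNet {V : Type u} (Γ : List (Formula V)) where
  Cut : Type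
  finite_cut : Finite Cut
  cut : Cut → Formula V
  link : Linking ((seqLeaf Γ).sum (cutLeaf cut))

namespace PreNet

variable {V : Type u} {Γ Γ' Δ : List (Formula V)}

/-- Renaming of the (unordered) cuts of a net. -/
def reindex (N : PreNet Γ) {κ : Type} (e : κ ≃ N.Cut) : PreNet Γ where
  Cut := κ
  finite_cut := haveI := N.finite_cut; Finite.of_equiv N.Cut e.symm
  cut := fun k => N.cut (e k)
  link := N.link.map ((AtomFlow.refl _).sumCongr
    (AtomFlow.sigmaReindex (fun i => (cutTree (N.cut i)).leaf) e))

/-- Two nets on the same conclusions are the same net: same cuts and same links. The cuts of a net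
are not ordered, so they have to agree only up to a bijection between the names of the cuts. -/
def Same (N M : PreNet Γ) : Prop := ∃ e : M.Cut ≃ N.Cut, M = N.reindex e

/-- The empty net. -/
def nil (V : Type u) : PreNet ([] : List (Formula V)) where
  Cut := Empty
  finite_cut := inferInstance
  cut := Empty.elim
  link := ⟨id, fun _ => rfl, by rintro (x | ⟨i, _⟩); exacts [x.elim, i.elim]⟩

/-- Replace the conclusions, tracing the atom occurrences along `e`. -/
def flow (N : PreNet Γ) (e : AtomFlow (seqLeaf Γ) (seqLeaf Δ)) : PreNet Δ where
  Cut := N.Cut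
  finite_cut := N.finite_cut
  cut := N.cut
  link := N.link.map (e.sumCongr (AtomFlow.refl _))

/-- Add fresh occurrences `A^⊥, A`, linked as in an identity axiom. -/
def addId (N : PreNet Γ) (A : Formula V)
    (e : AtomFlow ((A.dual.leaf.sum A.leaf).sum (seqLeaf Γ)) (seqLeaf Δ)) : PreNet Δ where
  Cut := N.Cut
  finite_cut := N.finite_cut
  cut := N.cut
  link := ((idLinking A).sum N.link).map
    ((AtomFlow.sumAssoc _ _ _).symm.trans (e.sumCongr (AtomFlow.refl _)))

/-- Turn occurrences of `A` and `A^⊥` in the conclusions into a cut `A ⦶ A^⊥`. -/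
def addCut (N : PreNet Γ) (A : Formula V)
    (e : AtomFlow (seqLeaf Γ) ((A.leaf.sum A.dual.leaf).sum (seqLeaf Δ))) : PreNet Δ where
  Cut := N.Cut ⊕ Unit
  finite_cut := haveI := N.finite_cut; inferInstance
  cut := Sum.elim N.cut fun _ => A
  link := N.link.map <|
    (e.sumCongr (AtomFlow.refl _)).trans <|
    ((AtomFlow.sumComm _ _).sumCongr (AtomFlow.refl _)).trans <|
    (AtomFlow.sumAssoc _ _ _).trans <|
    (AtomFlow.refl _).sumCongr <|
    (AtomFlow.sumComm _ _).trans <|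
    ((AtomFlow.refl _).sumCongr (AtomFlow.sigmaUnit (cutTree A).leaf).symm).trans
    (AtomFlow.sigmaSum (fun C => (cutTree C).leaf) N.cut (fun _ : Unit => A)).symm

/-- Put two nets side by side, and trace the atom occurrences of their conclusions along `e`. -/
def join (N : PreNet Γ) (M : PreNet Γ')
    (e : AtomFlow ((seqLeaf Γ).sum (seqLeaf Γ')) (seqLeaf Δ)) : PreNet Δ where
  Cut := N.Cut ⊕ M.Cut
  finite_cut := haveI := N.finite_cut; haveI := M.finite_cut; inferInstance
  cut := Sum.elim N.cut M.cut
  link := (N.link.sum M.link).map <|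
    (AtomFlow.sumSumComm _ _ _ _).trans <|
    e.sumCongr (AtomFlow.sigmaSum (fun C => (cutTree C).leaf) N.cut M.cut).symm

end PreNet

/-! ### The switching criterion -/

/-- The nodes of the formula tree of `A` (leaves and connectives). -/
def Formula.Node {V : Type u} : Formula V → Type
  | .atom _ => Unit
  | .par A B => Option (A.Node ⊕ B.Node)
  | .tens A B => Option (A.Node ⊕ B.Node)

/-- The root of the formula tree. -/
def Formula.root {V : Type u} : (A : Formula V) → A.Node
  | .atom _ => ()
  | .par _ _ => none
  | .tens _ _ => none

/-- A leaf, as a node. -/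
def Formula.leafNode {V : Type u} : (A : Formula V) → A.leaf.carrier → A.Node
  | .atom _, _ => ()
  | .par A _, .inl x => some (.inl (A.leafNode x))
  | .par _ B, .inr x => some (.inr (B.leafNode x))
  | .tens A _, .inl x => some (.inl (A.leafNode x))
  | .tens _ B, .inr x => some (.inr (B.leafNode x))

/-- A choice, for every `⅋`-node, of one of its two children (`true` for the left one): the edge to
that child is kept, the edge to the other one is removed. -/
def Formula.Switching {V : Type u} : Formula V → Type
  | .atom _ => Unit
  | .par A B => Bool × A.Switching × B.Switching
  | .tens A B => A.Switching × B.Switching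

/-- `A.Edge s x y`: in the formula tree of `A`, `y` is a child of `x`, and the edge between them is
kept by the switching `s`. -/
def Formula.Edge {V : Type u} : (A : Formula V) → A.Switching → A.Node → A.Node → Prop
  | .atom _, _, _, _ => False
  | .par A _, s, none, some (.inl y) => s.1 = true ∧ y = A.root
  | .par _ B, s, none, some (.inr y) => s.1 = false ∧ y = B.root
  | .par A _, s, some (.inl x), some (.inl y) => A.Edge s.2.1 x y
  | .par _ B, s, some (.inr x), some (.inr y) => B.Edge s.2.2 x y
  | .par _ _, _, _, _ => False
  | .tens A _, _, none, some (.inl y) => y = A.root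
  | .tens _ B, _, none, some (.inr y) => y = B.root
  | .tens A _, s, some (.inl x), some (.inl y) => A.Edge s.1 x y
  | .tens _ B, s, some (.inr x), some (.inr y) => B.Edge s.2 x y
  | .tens _ _, _, _, _ => False

/-- The nodes of a sequent forest. -/
def SeqNode {V : Type u} : List (Formula V) → Type
  | [] => Empty
  | A :: Γ => A.Node ⊕ SeqNode Γ

def seqLeafNode {V : Type u} : (Γ : List (Formula V)) → (seqLeaf Γ).carrier → SeqNode Γ
  | [], x => x.elim
  | A :: _, .inl x => .inl (A.leafNode x)
  | _ :: Γ, .inr x => .inr (seqLeafNode Γ x)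

def SeqSwitching {V : Type u} : List (Formula V) → Type
  | [] => Unit
  | A :: Γ => A.Switching × SeqSwitching Γ

def SeqEdge {V : Type u} : (Γ : List (Formula V)) → SeqSwitching Γ → SeqNode Γ → SeqNode Γ → Prop
  | [], _, _, _ => False
  | A :: _, s, .inl x, .inl y => A.Edge s.1 x y
  | _ :: Γ, s, .inr x, .inr y => SeqEdge Γ s.2 x y
  | _ :: _, _, _, _ => False

namespace PreNet

variable {V : Type u} {Γ : List (Formula V)}

/-- The nodes of a net: those of the conclusions and those of the cuts. -/
def Node (N : PreNet Γ) : Type := SeqNode Γ ⊕ ((i : N.Cut) × (cutTree (N.cut i)).Node)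

/-- A leaf of a net, as a node. -/
def leafNode (N : PreNet Γ) : ((seqLeaf Γ).sum (cutLeaf N.cut)).carrier → N.Node
  | .inl x => .inl (seqLeafNode Γ x)
  | .inr ⟨i, x⟩ => .inr ⟨i, (cutTree (N.cut i)).leafNode x⟩

/-- A switching of a net. -/
def Switching (N : PreNet Γ) : Type :=
  SeqSwitching Γ × ((i : N.Cut) → (cutTree (N.cut i)).Switching)

/-- The (oriented) edges that remain after switching: tree edges and links. -/
inductive Edge (N : PreNet Γ) (s : N.Switching) : N.Node → N.Node → Prop
  | concl {x y : SeqNode Γ} : SeqEdge Γ s.1 x y → Edge N s (.inl x) (.inl y)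
  | cut (i : N.Cut) {x y : (cutTree (N.cut i)).Node} :
      (cutTree (N.cut i)).Edge (s.2 i) x y → Edge N s (.inr ⟨i, x⟩) (.inr ⟨i, y⟩)
  | link (x : ((seqLeaf Γ).sum (cutLeaf N.cut)).carrier) :
      Edge N s (N.leafNode x) (N.leafNode (N.link.partner x))

/-- The undirected graph obtained from a net by a switching. -/
def switchingGraph (N : PreNet Γ) (s : N.Switching) : SimpleGraph N.Node :=
  SimpleGraph.fromRel (N.Edge s)

/-- The switching criterion: all switchings are connected and acyclic. A proof net is a pre-proof
net with this property. -/
def Correct (N : PreNet Γ) : Prop :=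
  ∀ s : N.Switching, (N.switchingGraph s).Connected ∧ (N.switchingGraph s).IsAcyclic

end PreNet

/-! ### Sequent calculus -/

/-- Sequent calculus proofs of the sequent `⊢ Γ`, where sequents are lists of formulas. -/
inductive SeqProof {V : Type u} : List (Formula V) → Type u
  | id (A : Formula V) : SeqProof [A.dual, A]
  | exch (Γ Δ : List (Formula V)) (A B : Formula V) :
      SeqProof (Γ ++ A :: B :: Δ) → SeqProof (Γ ++ B :: A :: Δ)
  | par (Γ Δ : List (Formula V)) (A B : Formula V) :
      SeqProof (Γ ++ A :: B :: Δ) → SeqProof (Γ ++ A.par B :: Δ)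
  | tens (Γ Δ : List (Formula V)) (A B : Formula V) :
      SeqProof (Γ ++ [A]) → SeqProof (B :: Δ) → SeqProof (Γ ++ A.tens B :: Δ)
  | cut (Γ Δ : List (Formula V)) (A : Formula V) :
      SeqProof (Γ ++ [A]) → SeqProof (A.dual :: Δ) → SeqProof (Γ ++ Δ)

section

variable {V : Type u}

/-- Tracing atoms through `exch`. -/
def exchFlow (Γ Δ : List (Formula V)) (A B : Formula V) :
    AtomFlow (seqLeaf (Γ ++ A :: B :: Δ)) (seqLeaf (Γ ++ B :: A :: Δ)) :=
  (appendFlow Γ (A :: B :: Δ)).trans <|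
    ((AtomFlow.refl _).sumCongr (AtomFlow.leftComm A.leaf B.leaf (seqLeaf Δ))).trans
    (appendFlow Γ (B :: A :: Δ)).symm

/-- Tracing atoms through the `⅋`-rule. -/
def parFlow (Γ Δ : List (Formula V)) (A B : Formula V) :
    AtomFlow (seqLeaf (Γ ++ A :: B :: Δ)) (seqLeaf (Γ ++ A.par B :: Δ)) :=
  (appendFlow Γ (A :: B :: Δ)).trans <|
    ((AtomFlow.refl _).sumCongr (AtomFlow.sumAssoc A.leaf B.leaf (seqLeaf Δ)).symm).trans
    (appendFlow Γ (A.par B :: Δ)).symm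

/-- The leaves of `Γ, A`. -/
def snocFlow (Γ : List (Formula V)) (A : Formula V) :
    AtomFlow (seqLeaf (Γ ++ [A])) ((seqLeaf Γ).sum A.leaf) :=
  (appendFlow Γ [A]).trans ((AtomFlow.refl _).sumCongr (AtomFlow.sumEmpty A.leaf))

/-- Tracing atoms through the `⊗`-rule. -/
def tensFlow (Γ Δ : List (Formula V)) (A B : Formula V) :
    AtomFlow ((seqLeaf (Γ ++ [A])).sum (seqLeaf (B :: Δ))) (seqLeaf (Γ ++ A.tens B :: Δ)) :=
  ((snocFlow Γ A).sumCongr (AtomFlow.refl _)).trans <|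
    (AtomFlow.sumAssoc (seqLeaf Γ) A.leaf (B.leaf.sum (seqLeaf Δ))).trans <|
    ((AtomFlow.refl _).sumCongr (AtomFlow.sumAssoc A.leaf B.leaf (seqLeaf Δ)).symm).trans
    (appendFlow Γ (A.tens B :: Δ)).symm

/-- Tracing atoms through the cut rule: the atoms of `A` and `A^⊥` go to the cut `A ⦶ A^⊥`. -/
def cutFlow (Γ Δ : List (Formula V)) (A : Formula V) :
    AtomFlow (seqLeaf ((Γ ++ [A]) ++ A.dual :: Δ))
      ((A.leaf.sum A.dual.leaf).sum (seqLeaf (Γ ++ Δ))) :=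
  (appendFlow (Γ ++ [A]) (A.dual :: Δ)).trans <|
    (((snocFlow Γ A).trans (AtomFlow.sumComm _ _)).sumCongr (AtomFlow.refl _)).trans <|
    (AtomFlow.sumSumComm A.leaf (seqLeaf Γ) A.dual.leaf (seqLeaf Δ)).trans <|
    (AtomFlow.refl _).sumCongr (appendFlow Γ Δ).symm

/-- The net of a sequent calculus proof, obtained by tracing all atom occurrences through the
proof, without flowing through the cuts. -/
def SeqProof.net : {Γ : List (Formula V)} → SeqProof Γ → PreNet Γ
  | _, .id A => (PreNet.nil V).addId A
      (AtomFlow.sumAssoc A.dual.leaf A.leaf (OccSet.empty V))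
  | _, .exch Γ Δ A B p => p.net.flow (exchFlow Γ Δ A B)
  | _, .par Γ Δ A B p => p.net.flow (parFlow Γ Δ A B)
  | _, .tens Γ Δ A B p q => p.net.join q.net (tensFlow Γ Δ A B)
  | _, .cut Γ Δ A p q =>
      (p.net.join q.net (appendFlow (Γ ++ [A]) (A.dual :: Δ)).symm).addCut A (cutFlow Γ Δ A)

end

/-! ### Calculus of structures -/

/-- Formula contexts `S{ }`. All of them are positive, since negation occurs on atoms only. -/
inductive Ctx (V : Type u) : Type u
  | hole : Ctx V
  | parL (S : Ctx V) (B : Formula V) : Ctx V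
  | parR (A : Formula V) (S : Ctx V) : Ctx V
  | tensL (S : Ctx V) (B : Formula V) : Ctx V
  | tensR (A : Formula V) (S : Ctx V) : Ctx V

/-- `S{X}`. -/
def Ctx.fill {V : Type u} : Ctx V → Formula V → Formula V
  | .hole, X => X
  | .parL S B, X => .par (S.fill X) B
  | .parR A S, X => .par A (S.fill X)
  | .tensL S B, X => .tens (S.fill X) B
  | .tensR A S, X => .tens A (S.fill X)

/-- The atom occurrences of a context. -/
def Ctx.leaf {V : Type u} : Ctx V → OccSet V
  | .hole => OccSet.empty V
  | .parL S B => S.leaf.sum B.leaf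
  | .parR A S => A.leaf.sum S.leaf
  | .tensL S B => S.leaf.sum B.leaf
  | .tensR A S => A.leaf.sum S.leaf

/-- The atom occurrences of `S{X}` are those of `X` and those of `S{ }`. -/
def fillFlow {V : Type u} : (S : Ctx V) → (X : Formula V) →
    AtomFlow (S.fill X).leaf (X.leaf.sum S.leaf)
  | .hole, X => (AtomFlow.sumEmpty X.leaf).symm
  | .parL S B, X => ((fillFlow S X).sumCongr (AtomFlow.refl B.leaf)).trans
      (AtomFlow.sumAssoc X.leaf S.leaf B.leaf)
  | .parR A S, X => ((AtomFlow.refl A.leaf).sumCongr (fillFlow S X)).trans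
      (AtomFlow.leftComm A.leaf X.leaf S.leaf)
  | .tensL S B, X => ((fillFlow S X).sumCongr (AtomFlow.refl B.leaf)).trans
      (AtomFlow.sumAssoc X.leaf S.leaf B.leaf)
  | .tensR A S, X => ((AtomFlow.refl A.leaf).sumCongr (fillFlow S X)).trans
      (AtomFlow.leftComm A.leaf X.leaf S.leaf)

/-- Instances of the inference rules of the calculus of structures, from premise to conclusion.
`none` stands for the absence of a formula. -/
inductive Step {V : Type u} : Option (Formula V) → Option (Formula V) → Type u
  | idown0 (A : Formula V) : Step none (some (A.dual.par A))
  | iup0 (A : Formula V) : Step (some (A.tens A.dual)) none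
  | idown (S : Ctx V) (A B : Formula V) :
      Step (some (S.fill B)) (some (S.fill ((A.dual.par A).tens B)))
  | iup (S : Ctx V) (A B : Formula V) :
      Step (some (S.fill (B.par (A.tens A.dual)))) (some (S.fill B))
  | comDown (S : Ctx V) (A B : Formula V) :
      Step (some (S.fill (A.par B))) (some (S.fill (B.par A)))
  | comUp (S : Ctx V) (A B : Formula V) :
      Step (some (S.fill (A.tens B))) (some (S.fill (B.tens A)))
  | assDown (S : Ctx V) (A B C : Formula V) :
      Step (some (S.fill (A.par (B.par C)))) (some (S.fill ((A.par B).par C)))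
  | assUp (S : Ctx V) (A B C : Formula V) :
      Step (some (S.fill (A.tens (B.tens C)))) (some (S.fill ((A.tens B).tens C)))
  | switch (S : Ctx V) (A B C : Formula V) :
      Step (some (S.fill (A.tens (B.par C)))) (some (S.fill ((A.tens B).par C)))

/-- Derivations without premise in the calculus of structures, i.e. finite chains of rule instances
that start from nothing. `CosProof (some A)` is the type of proofs of the formula `A`. -/
inductive CosProof {V : Type u} : Option (Formula V) → Type u
  | nil : CosProof none
  | snoc {X Y : Option (Formula V)} : CosProof X → Step X Y → CosProof Y

section

variable {V : Type u}

/-- Tracing atoms through a rule instance that rearranges the atoms of the formula in the context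
and leaves the context alone. -/
def deepFlow (S : Ctx V) {X Y : Formula V} (e : AtomFlow X.leaf Y.leaf) :
    AtomFlow (seqLeaf [S.fill X]) (seqLeaf [S.fill Y]) :=
  ((fillFlow S X).trans ((e.sumCongr (AtomFlow.refl _)).trans (fillFlow S Y).symm)).sumCongr
    (AtomFlow.refl _)

/-- Tracing atoms through deep `i↓`. -/
def idownFlow (S : Ctx V) (A B : Formula V) :
    AtomFlow ((A.dual.leaf.sum A.leaf).sum (seqLeaf [S.fill B]))
      (seqLeaf [S.fill ((A.dual.par A).tens B)]) :=
  (AtomFlow.sumAssoc _ (S.fill B).leaf (OccSet.empty V)).symm.trans <|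
    (((AtomFlow.refl _).sumCongr (fillFlow S B)).trans <|
      (AtomFlow.sumAssoc _ B.leaf S.leaf).symm.trans
      (fillFlow S ((A.dual.par A).tens B)).symm).sumCongr (AtomFlow.refl _)

/-- Tracing atoms through deep `i↑`: the atoms of `A ⊗ A^⊥` go to the cut `A ⦶ A^⊥`. -/
def iupFlow (S : Ctx V) (A B : Formula V) :
    AtomFlow (seqLeaf [S.fill (B.par (A.tens A.dual))])
      ((A.leaf.sum A.dual.leaf).sum (seqLeaf [S.fill B])) :=
  (((fillFlow S (B.par (A.tens A.dual))).trans <|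
      ((AtomFlow.sumComm B.leaf (A.leaf.sum A.dual.leaf)).sumCongr (AtomFlow.refl S.leaf)).trans <|
      (AtomFlow.sumAssoc _ B.leaf S.leaf).trans <|
      (AtomFlow.refl _).sumCongr (fillFlow S B).symm).sumCongr
    (AtomFlow.refl (OccSet.empty V))).trans
  (AtomFlow.sumAssoc _ (S.fill B).leaf (OccSet.empty V))

/-- The effect of a rule instance on nets: atom occurrences are traced from premise to conclusion;
`i↓` adds links, and `i↑` adds a cut. -/
def Step.apply : {X Y : Option (Formula V)} → Step X Y → PreNet X.toList → PreNet Y.toList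
  | _, _, .idown0 A, N => N.addId (Δ := [A.dual.par A]) A (AtomFlow.refl _)
  | _, _, .iup0 A, N => N.addCut (Γ := [A.tens A.dual]) (Δ := []) A (AtomFlow.refl _)
  | _, _, .idown S A B, N => N.addId A (idownFlow S A B)
  | _, _, .iup S A B, N => N.addCut A (iupFlow S A B)
  | _, _, .comDown S A B, N => N.flow
      (deepFlow S (X := A.par B) (Y := B.par A) (AtomFlow.sumComm A.leaf B.leaf))
  | _, _, .comUp S A B, N => N.flow
      (deepFlow S (X := A.tens B) (Y := B.tens A) (AtomFlow.sumComm A.leaf B.leaf))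
  | _, _, .assDown S A B C, N => N.flow
      (deepFlow S (X := A.par (B.par C)) (Y := (A.par B).par C)
        (AtomFlow.sumAssoc A.leaf B.leaf C.leaf).symm)
  | _, _, .assUp S A B C, N => N.flow
      (deepFlow S (X := A.tens (B.tens C)) (Y := (A.tens B).tens C)
        (AtomFlow.sumAssoc A.leaf B.leaf C.leaf).symm)
  | _, _, .switch S A B C, N => N.flow
      (deepFlow S (X := A.tens (B.par C)) (Y := (A.tens B).par C)
        (AtomFlow.sumAssoc A.leaf B.leaf C.leaf).symm)

/-- The net of a derivation without premise in the calculus of structures. -/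
def CosProof.net : {X : Option (Formula V)} → CosProof X → PreNet X.toList
  | _, .nil => PreNet.nil V
  | _, .snoc p r => r.apply p.net

/-! ### The formula `A₁ ⅋ ⋯ ⅋ Aₙ` -/

/-- `ParOf [A₁, …, Aₙ] F`: the formula `F` is `A₁ ⅋ A₂ ⅋ ⋯ ⅋ Aₙ` for some choice of the
parentheses (so `n ≥ 1`). -/
inductive ParOf : List (Formula V) → Formula V → Type u
  | single (A : Formula V) : ParOf [A] A
  | par {Γ Δ : List (Formula V)} {F G : Formula V} :
      ParOf Γ F → ParOf Δ G → ParOf (Γ ++ Δ) (F.par G)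

/-- The leaves of `A₁ ⅋ ⋯ ⅋ Aₙ` are those of `A₁, …, Aₙ`. -/
def ParOf.flow : {Γ : List (Formula V)} → {F : Formula V} → ParOf Γ F →
    AtomFlow (seqLeaf Γ) F.leaf
  | _, _, .single A => AtomFlow.sumEmpty A.leaf
  | _, _, .par (Γ := Γ) (Δ := Δ) b c => (appendFlow Γ Δ).trans (b.flow.sumCongr c.flow)

/-- A net with conclusions `A₁, …, Aₙ`, read as a net with the single conclusion `A₁ ⅋ ⋯ ⅋ Aₙ`:
same linking, same cuts. -/
def PreNet.parConclusions {Γ : List (Formula V)} {F : Formula V} (N : PreNet Γ) (b : ParOf Γ F) :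
    PreNet [F] :=
  N.flow (Δ := [F]) (b.flow.trans (AtomFlow.sumEmpty F.leaf).symm)

/-- `N`, with conclusions `A₁, …, Aₙ`, and `M`, with conclusion `A₁ ⅋ ⋯ ⅋ Aₙ`, are the same proof
net: both are correct, and they differ only in the `⅋`s that join the conclusions. -/
def SameProofNet {Γ : List (Formula V)} {F : Formula V} (b : ParOf Γ F)
    (N : PreNet Γ) (M : PreNet [F]) : Prop :=
  N.Correct ∧ M.Correct ∧ (N.parConclusions b).Same M

end

end MLL

namespace MLL

universe u v

/-! ### Decorated formulas -/

section Decoration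

variable {V : Type u} {W : Type v}

/-! The tracing of atoms is turned into syntax. Give each leaf of a net its atom with an extra tag
on the variable, so that linked leaves carry dual tagged atoms (`PreNet.Decor`). If all these labels
are different, the links can be read off from them, because the partner of a leaf is the only leaf
with the dual label. The net is then determined by its tagged conclusions and the multiset of its
tagged cuts, each written as a tensor (`PreNet.same_of_decor`). Such a tagging always exists
(`PreNet.exists_injective_decor`).

In tagged form a cut is A ⊗ A', where A' is dual to A only after the tags are forgotten (`IsCut`). A
cut rule thus becomes an ordinary ⊗-rule, and proofs with cuts become cut-free derivations (`Prov`)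
of the tagged conclusions together with the tagged cuts. For the sequent calculus this is immediate
(`SeqProof.prov`). For the calculus of structures it says that the deep rules are admissible
(`CosProof.prov`): ⅋ is invertible, and a proof containing A ⊗ B can be modified at the rule that
introduces this tensor.

Conversely, a cut-free derivation can be read in either calculus. `Prov.realSeq` turns the ⊗-rules
that introduce tagged cuts back into cut rules. `Prov.dcos` simulates the sequent rules under a
large ⅋, and `DCos.cuts` then removes the tagged cuts by i↑. `RealSeq` and `RealCos` express that
the result is the tagged net of an actual untagged proof. Passing through `Prov` with an injective
tagging therefore translates each calculus into the other without changing the net.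

Correctness also comes from `Prov`, since the tags are arbitrary. Given a switching, tag each leaf
by its connected component; induction on the derivation shows that only one tag occurs
(`Prov.exists_all_eq`), so the graph is connected. Moreover, the number of leaves minus twice the
number of tensors is 2 for every derivable sequent (`Prov.sum_val`), which leaves too few edges for
a cycle. -/

/-- Renaming of the propositional variable of an atom. -/
def Atom.map (π : W → V) : Atom W → Atom V
  | .pos a => .pos (π a)
  | .neg a => .neg (π a)

theorem Atom.map_dual (π : W → V) (x : Atom W) : x.dual.map π = (x.map π).dual := by
  cases x <;> rfl

/-- Renaming of the propositional variables of a formula. -/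
def Formula.map (π : W → V) : Formula W → Formula V
  | .atom x => .atom (x.map π)
  | .par A B => .par (A.map π) (B.map π)
  | .tens A B => .tens (A.map π) (B.map π)

theorem Formula.map_dual (π : W → V) (A : Formula W) : A.dual.map π = (A.map π).dual := by
  induction A with
  | atom x => simp [Formula.map, Formula.dual, Atom.map_dual]
  | par A B hA hB => simp [Formula.map, Formula.dual, hA, hB]
  | tens A B hA hB => simp [Formula.map, Formula.dual, hA, hB]

/-- The formula obtained by replacing the leaves of `A` by the atoms given by `d`. -/
def Formula.deco : (A : Formula V) → (A.leaf.carrier → Atom W) → Formula W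
  | .atom _, d => .atom (d ())
  | .par A B, d => .par (A.deco fun x => d (.inl x)) (B.deco fun x => d (.inr x))
  | .tens A B, d => .tens (A.deco fun x => d (.inl x)) (B.deco fun x => d (.inr x))

theorem Formula.map_deco (π : W → V) (A : Formula V) (d : A.leaf.carrier → Atom W)
    (h : ∀ x, (d x).map π = A.leaf.lab x) : (A.deco d).map π = A := by
  induction A with
  | atom x => exact congrArg Formula.atom (h ())
  | par A B hA hB =>
    exact congrArg₂ Formula.par (hA _ fun x => h (.inl x)) (hB _ fun x => h (.inr x))
  | tens A B hA hB =>
    exact congrArg₂ Formula.tens (hA _ fun x => h (.inl x)) (hB _ fun x => h (.inr x))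

theorem Formula.deco_injective (A : Formula V) :
    Function.Injective (A.deco (W := W)) := by
  induction A with
  | atom x =>
    intro d d' h
    funext u
    cases u
    simpa [Formula.deco] using h
  | par A B hA hB =>
    intro d d' h
    simp only [Formula.deco, Formula.par.injEq] at h
    funext u
    rcases u with u | u
    exacts [congrFun (hA h.1) u, congrFun (hB h.2) u]
  | tens A B hA hB =>
    intro d d' h
    simp only [Formula.deco, Formula.tens.injEq] at h
    funext u
    rcases u with u | u
    exacts [congrFun (hA h.1) u, congrFun (hB h.2) u]

theorem Formula.exists_deco (π : W → V) (A : Formula W) :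
    ∃ d : (A.map π).leaf.carrier → Atom W,
      (A.map π).deco d = A ∧ ∀ x, (d x).map π = (A.map π).leaf.lab x := by
  induction A with
  | atom x => exact ⟨fun _ => x, rfl, fun _ => rfl⟩
  | par A B hA hB =>
    obtain ⟨d, hd, hd'⟩ := hA
    obtain ⟨f, hf, hf'⟩ := hB
    exact ⟨Sum.elim d f, congrArg₂ Formula.par hd hf, by rintro (x | x); exacts [hd' x, hf' x]⟩
  | tens A B hA hB =>
    obtain ⟨d, hd, hd'⟩ := hA
    obtain ⟨f, hf, hf'⟩ := hB
    exact ⟨Sum.elim d f, congrArg₂ Formula.tens hd hf, by rintro (x | x); exacts [hd' x, hf' x]⟩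

/-- This connects the two notions of duality: labels that are dual along the identity links, and
tagged formulas that are dual as syntax. -/
theorem Formula.deco_dual_eq_iff (A : Formula V) (d' : A.dual.leaf.carrier → Atom W)
    (d : A.leaf.carrier → Atom W) :
    A.dual.deco d' = (A.deco d).dual ↔ ∀ x, d' (dualLeaf A x) = (d x).dual := by
  induction A with
  | atom x =>
    constructor
    · intro h u
      exact Formula.atom.inj h
    · intro h
      exact congrArg Formula.atom (h ())
  | par A B hA hB =>
    refine Iff.trans (b := A.dual.deco (fun x => d' (.inr x)) = (A.deco fun x => d (.inl x)).dual ∧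
      B.dual.deco (fun x => d' (.inl x)) = (B.deco fun x => d (.inr x)).dual) ?_ ?_
    · simp only [Formula.deco, Formula.dual, Formula.tens.injEq]
      exact and_comm
    · rw [hA, hB]
      exact ⟨fun h => by rintro (x | x); exacts [h.1 x, h.2 x],
        fun h => ⟨fun x => h (.inl x), fun x => h (.inr x)⟩⟩
  | tens A B hA hB =>
    refine Iff.trans (b := A.dual.deco (fun x => d' (.inr x)) = (A.deco fun x => d (.inl x)).dual ∧
      B.dual.deco (fun x => d' (.inl x)) = (B.deco fun x => d (.inr x)).dual) ?_ ?_
    · simp only [Formula.deco, Formula.dual, Formula.par.injEq]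
      exact and_comm
    · rw [hA, hB]
      exact ⟨fun h => by rintro (x | x); exacts [h.1 x, h.2 x],
        fun h => ⟨fun x => h (.inl x), fun x => h (.inr x)⟩⟩

/-- The sequent obtained by replacing the leaves of `Γ` by the atoms given by `d`. -/
def seqDeco : (Γ : List (Formula V)) → ((seqLeaf Γ).carrier → Atom W) → List (Formula W)
  | [], _ => []
  | A :: Γ, d => A.deco (fun x => d (.inl x)) :: seqDeco Γ fun x => d (.inr x)

theorem length_seqDeco (Γ : List (Formula V)) (d : (seqLeaf Γ).carrier → Atom W) :
    (seqDeco Γ d).length = Γ.length := by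
  induction Γ with
  | nil => rfl
  | cons A Γ h => simp [seqDeco, h]

theorem map_seqDeco (π : W → V) (Γ : List (Formula V)) (d : (seqLeaf Γ).carrier → Atom W)
    (h : ∀ x, (d x).map π = (seqLeaf Γ).lab x) : (seqDeco Γ d).map (Formula.map π) = Γ := by
  induction Γ with
  | nil => rfl
  | cons A Γ ih =>
    simp only [seqDeco, List.map_cons, List.cons.injEq]
    exact ⟨A.map_deco π _ fun x => h (.inl x), ih _ fun x => h (.inr x)⟩

theorem seqDeco_injective (Γ : List (Formula V)) :
    Function.Injective (seqDeco (W := W) Γ) := by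
  induction Γ with
  | nil => intro d d' _; funext u; exact u.elim
  | cons A Γ ih =>
    intro d d' h
    simp only [seqDeco, List.cons.injEq] at h
    funext u
    rcases u with u | u
    exacts [congrFun (A.deco_injective h.1) u, congrFun (ih h.2) u]

theorem seqDeco_append (Γ Δ : List (Formula V)) (d : (seqLeaf (Γ ++ Δ)).carrier → Atom W) :
    seqDeco (Γ ++ Δ) d =
      seqDeco Γ (fun x => d ((appendFlow Γ Δ).equiv.symm (.inl x))) ++
      seqDeco Δ (fun x => d ((appendFlow Γ Δ).equiv.symm (.inr x))) := by
  induction Γ with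
  | nil => rfl
  | cons A Γ ih =>
    simp only [List.cons_append, seqDeco]
    rw [ih]
    rfl

theorem seqDeco_append' (Γ Δ : List (Formula V))
    (d : (seqLeaf Γ).carrier ⊕ (seqLeaf Δ).carrier → Atom W) :
    seqDeco (Γ ++ Δ) (fun x => d ((appendFlow Γ Δ).equiv x)) =
      seqDeco Γ (fun x => d (.inl x)) ++ seqDeco Δ (fun x => d (.inr x)) := by
  simp [seqDeco_append]

/-- The context obtained by replacing the leaves of `S` by the atoms given by `d`. -/
def Ctx.deco : (S : Ctx V) → (S.leaf.carrier → Atom W) → Ctx W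
  | .hole, _ => .hole
  | .parL S B, d => .parL (S.deco fun x => d (.inl x)) (B.deco fun x => d (.inr x))
  | .parR A S, d => .parR (A.deco fun x => d (.inl x)) (S.deco fun x => d (.inr x))
  | .tensL S B, d => .tensL (S.deco fun x => d (.inl x)) (B.deco fun x => d (.inr x))
  | .tensR A S, d => .tensR (A.deco fun x => d (.inl x)) (S.deco fun x => d (.inr x))

/-- Renaming of the propositional variables of a context. -/
def Ctx.map (π : W → V) : Ctx W → Ctx V
  | .hole => .hole
  | .parL S B => .parL (S.map π) (B.map π)
  | .parR A S => .parR (A.map π) (S.map π)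
  | .tensL S B => .tensL (S.map π) (B.map π)
  | .tensR A S => .tensR (A.map π) (S.map π)

theorem Ctx.map_fill (π : W → V) (S : Ctx W) (X : Formula W) :
    (S.fill X).map π = (S.map π).fill (X.map π) := by
  induction S <;> simp_all [Ctx.fill, Ctx.map, Formula.map]

theorem Ctx.deco_fill (S : Ctx V) (X : Formula V) (d : (S.fill X).leaf.carrier → Atom W) :
    (S.fill X).deco d =
      (S.deco fun x => d ((fillFlow S X).equiv.symm (.inr x))).fill
        (X.deco fun x => d ((fillFlow S X).equiv.symm (.inl x))) := by
  induction S with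
  | hole => rfl
  | parL S B ih =>
    refine (congrArg₂ Formula.par (ih _) rfl).trans ?_
    rfl
  | parR A S ih =>
    refine (congrArg₂ Formula.par rfl (ih _)).trans ?_
    rfl
  | tensL S B ih =>
    refine (congrArg₂ Formula.tens (ih _) rfl).trans ?_
    rfl
  | tensR A S ih =>
    refine (congrArg₂ Formula.tens rfl (ih _)).trans ?_
    rfl

/-- The common untagged context fixes the path to the hole, so the filled formula splits there in
only one way. -/
theorem Ctx.fill_inj_of_map_eq (π : W → V) {S T : Ctx W} {X Y : Formula W}
    (h : S.map π = T.map π) (h' : S.fill X = T.fill Y) : S = T ∧ X = Y := by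
  induction S generalizing T with
  | hole => cases T <;> simp_all [Ctx.map, Ctx.fill]
  | parL S B ih =>
    cases T with
    | parL _ _ =>
      simp only [Ctx.map, Ctx.parL.injEq, Ctx.fill, Formula.par.injEq] at h h'
      obtain ⟨h₁, h₂⟩ := ih h.1 h'.1
      exact ⟨by rw [h₁, h'.2], h₂⟩
    | _ => simp [Ctx.map] at h
  | parR A S ih =>
    cases T with
    | parR _ _ =>
      simp only [Ctx.map, Ctx.parR.injEq, Ctx.fill, Formula.par.injEq] at h h'
      obtain ⟨h₁, h₂⟩ := ih h.2 h'.2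
      exact ⟨by rw [h₁, h'.1], h₂⟩
    | _ => simp [Ctx.map] at h
  | tensL S B ih =>
    cases T with
    | tensL _ _ =>
      simp only [Ctx.map, Ctx.tensL.injEq, Ctx.fill, Formula.tens.injEq] at h h'
      obtain ⟨h₁, h₂⟩ := ih h.1 h'.1
      exact ⟨by rw [h₁, h'.2], h₂⟩
    | _ => simp [Ctx.map] at h
  | tensR A S ih =>
    cases T with
    | tensR _ _ =>
      simp only [Ctx.map, Ctx.tensR.injEq, Ctx.fill, Formula.tens.injEq] at h h'
      obtain ⟨h₁, h₂⟩ := ih h.2 h'.2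
      exact ⟨by rw [h₁, h'.1], h₂⟩
    | _ => simp [Ctx.map] at h

theorem Ctx.map_deco (π : W → V) (S : Ctx V) (d : S.leaf.carrier → Atom W)
    (h : ∀ x, (d x).map π = S.leaf.lab x) : (S.deco d).map π = S := by
  induction S with
  | hole => rfl
  | parL S B ih =>
    exact congrArg₂ Ctx.parL (ih _ fun x => h (.inl x))
      (B.map_deco π _ fun x => h (.inr x))
  | parR A S ih =>
    exact congrArg₂ Ctx.parR (A.map_deco π _ fun x => h (.inl x))
      (ih _ fun x => h (.inr x))
  | tensL S B ih =>
    exact congrArg₂ Ctx.tensL (ih _ fun x => h (.inl x))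
      (B.map_deco π _ fun x => h (.inr x))
  | tensR A S ih =>
    exact congrArg₂ Ctx.tensR (A.map_deco π _ fun x => h (.inl x))
      (ih _ fun x => h (.inr x))

/-! ### Finite families as multisets -/

/-- The multiset of the members of a finite family. -/
noncomputable def famDeco {ι : Type} {α : Type*} [Finite ι] (f : ι → α) : Multiset α :=
  letI := Fintype.ofFinite ι
  (Finset.univ : Finset ι).val.map f

theorem famDeco_eq {ι : Type} {α : Type*} [Fintype ι] (f : ι → α) :
    famDeco f = (Finset.univ : Finset ι).val.map f := by
  unfold famDeco
  congr!

theorem famDeco_empty {ι : Type} {α : Type*} [Finite ι] [IsEmpty ι] (f : ι → α) :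
    famDeco f = 0 := by
  let _ := Fintype.ofFinite ι
  simp [famDeco_eq]

theorem famDeco_unit {α : Type*} (f : Unit → α) : famDeco f = {f ()} := by
  simp [famDeco_eq]

theorem famDeco_sum {ι κ : Type} {α : Type*} [Finite ι] [Finite κ] (f : ι ⊕ κ → α) :
    famDeco f = famDeco (fun i => f (.inl i)) + famDeco fun k => f (.inr k) := by
  let _ := Fintype.ofFinite ι
  let _ := Fintype.ofFinite κ
  simp only [famDeco_eq]
  rw [← Finset.univ_disjSum_univ, Finset.val_disjSum]
  simp [Multiset.disjSum]

theorem mem_famDeco {ι : Type} {α : Type*} [Finite ι] {f : ι → α} {a : α} :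
    a ∈ famDeco f ↔ ∃ i, f i = a := by
  let _ := Fintype.ofFinite ι
  simp [famDeco_eq]

theorem exists_equiv_of_famDeco_eq {ι κ : Type} {α : Type*} [Finite ι] [Finite κ]
    {f : ι → α} {g : κ → α} (h : famDeco f = famDeco g) : ∃ e : κ ≃ ι, ∀ k, f (e k) = g k := by
  let _ := Fintype.ofFinite ι
  let _ := Fintype.ofFinite κ
  rw [famDeco_eq, famDeco_eq] at h
  classical
  -- Equal multiplicities make the fibres over each value equinumerous; the bijections between
  -- fibres are then glued.
  have hcard (a : α) : Nonempty ({k // g k = a} ≃ {i // f i = a}) := by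
    refine Fintype.card_eq.1 ?_
    have := congrArg (Multiset.count a) h
    simp only [Multiset.count_map] at this
    rw [Fintype.card_subtype, Fintype.card_subtype]
    simp only [eq_comm (b := a)]
    exact this.symm
  exact ⟨Equiv.ofFiberEquiv fun a => (hcard a).some, fun k => Equiv.ofFiberEquiv_map _ k⟩

end Decoration

/-! ### Decorated nets -/

section DecoratedNets

variable {V : Type u} {W : Type v} (π : W → V)

/-- `d` assigns to each occurrence an atom over its label, such that partners get dual atoms. -/
def Linking.Decor {X : OccSet V} (l : Linking X) (d : X.carrier → Atom W) : Prop :=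
  (∀ x, (d x).map π = X.lab x) ∧ ∀ x, d (l.partner x) = (d x).dual

variable {π}

theorem Linking.decor_map {X Y : OccSet V} (e : AtomFlow X Y) (l : Linking X)
    (d : Y.carrier → Atom W) : (l.map e).Decor π d ↔ l.Decor π fun x => d (e.equiv x) := by
  constructor
  · rintro ⟨h, h'⟩
    refine ⟨fun x => (h _).trans (e.lab_eq x), fun x => ?_⟩
    simpa [Linking.map] using h' (e.equiv x)
  · rintro ⟨h, h'⟩
    constructor
    · intro y
      obtain ⟨x, rfl⟩ := e.equiv.surjective y
      exact (h x).trans (e.lab_eq x).symm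
    · intro y
      obtain ⟨x, rfl⟩ := e.equiv.surjective y
      simpa [Linking.map] using h' x

theorem Linking.decor_sum {X Y : OccSet V} (l : Linking X) (m : Linking Y)
    (d : (X.sum Y).carrier → Atom W) : (l.sum m).Decor π d ↔
      l.Decor π (fun x => d (.inl x)) ∧ m.Decor π (fun y => d (.inr y)) := by
  constructor
  · rintro ⟨h, h'⟩
    exact ⟨⟨fun x => h (.inl x), fun x => h' (.inl x)⟩, ⟨fun x => h (.inr x), fun x => h' (.inr x)⟩⟩
  · rintro ⟨⟨h, h'⟩, ⟨k, k'⟩⟩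
    exact ⟨by rintro (x | x); exacts [h x, k x], by rintro (x | x); exacts [h' x, k' x]⟩

theorem decor_idLinking (A : Formula V) (d : (A.dual.leaf.sum A.leaf).carrier → Atom W) :
    (idLinking A).Decor π d ↔ (∀ x, (d (.inr x)).map π = A.leaf.lab x) ∧
      A.dual.deco (fun y => d (.inl y)) = (A.deco fun x => d (.inr x)).dual := by
  rw [Formula.deco_dual_eq_iff]
  constructor
  · rintro ⟨h, h'⟩
    exact ⟨fun x => h (.inr x), fun x => h' (.inr x)⟩
  · rintro ⟨h, h'⟩
    constructor
    · rintro (y | x)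
      · obtain ⟨x, rfl⟩ := (dualLeaf A).surjective y
        change (d (.inl _)).map π = A.dual.leaf.lab _
        rw [h', Atom.map_dual, h, lab_dualLeaf]
      · exact h x
    · rintro (y | x)
      · obtain ⟨x, rfl⟩ := (dualLeaf A).surjective y
        change d (.inr ((dualLeaf A).symm _)) = (d (.inl _)).dual
        rw [h', Atom.dual_dual, Equiv.symm_apply_apply]
      · exact h' x

namespace PreNet

variable {Γ Γ' Δ : List (Formula V)}

attribute [instance] PreNet.finite_cut

variable (π) in
/-- A decoration of the leaves of a net (`d` for the conclusions and `c` for the cuts) by atoms over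
their labels, such that linked leaves get dual atoms. -/
def Decor (N : PreNet Γ) (d : (seqLeaf Γ).carrier → Atom W)
    (c : (i : N.Cut) → (cutTree (N.cut i)).leaf.carrier → Atom W) : Prop :=
  N.link.Decor π (Sum.elim d fun p => c p.1 p.2)

/-- The decorated cuts of a net, as tensor formulas. -/
noncomputable def cutDeco (N : PreNet Γ)
    (c : (i : N.Cut) → (cutTree (N.cut i)).leaf.carrier → Atom W) : Multiset (Formula W) :=
  famDeco fun i => (cutTree (N.cut i)).deco (c i)

theorem decor_nil (d : (seqLeaf ([] : List (Formula V))).carrier → Atom W) (c) :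
    (nil V).Decor π d c :=
  ⟨by rintro (x | ⟨i, _⟩); exacts [x.elim, i.elim],
    by rintro (x | ⟨i, _⟩); exacts [x.elim, i.elim]⟩

theorem decor_flow (N : PreNet Γ) (e : AtomFlow (seqLeaf Γ) (seqLeaf Δ))
    (d : (seqLeaf Δ).carrier → Atom W)
    (c : (i : N.Cut) → (cutTree (N.cut i)).leaf.carrier → Atom W) :
    (N.flow e).Decor π d c ↔ N.Decor π (fun x => d (e.equiv x)) c := by
  refine (Linking.decor_map _ _ _).trans (iff_of_eq (congrArg _ ?_))
  funext x
  rcases x with x | x <;> rfl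

theorem decor_addId (N : PreNet Γ) (A : Formula V)
    (e : AtomFlow ((A.dual.leaf.sum A.leaf).sum (seqLeaf Γ)) (seqLeaf Δ))
    (d : (seqLeaf Δ).carrier → Atom W)
    (c : (i : N.Cut) → (cutTree (N.cut i)).leaf.carrier → Atom W) :
    (N.addId A e).Decor π d c ↔
      ((∀ x, (d (e.equiv (.inl (.inr x)))).map π = A.leaf.lab x) ∧
        A.dual.deco (fun y => d (e.equiv (.inl (.inl y)))) =
          (A.deco fun x => d (e.equiv (.inl (.inr x)))).dual) ∧
      N.Decor π (fun x => d (e.equiv (.inr x))) c := by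
  refine (Linking.decor_map _ _ _).trans ((Linking.decor_sum _ _ _).trans
    (and_congr (decor_idLinking _ _) (iff_of_eq (congrArg _ ?_))))
  funext x
  rcases x with x | x <;> rfl

/-- No duality is demanded between the tags of the two halves of the new cut. This is why a tagged
cut is only a tensor. -/
theorem decor_addCut (N : PreNet Γ) (A : Formula V)
    (e : AtomFlow (seqLeaf Γ) ((A.leaf.sum A.dual.leaf).sum (seqLeaf Δ)))
    (d : (seqLeaf Δ).carrier → Atom W)
    (c : (i : N.Cut ⊕ Unit) → (cutTree (Sum.elim N.cut (fun _ => A) i)).leaf.carrier → Atom W) :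
    (N.addCut A e).Decor π d c ↔
      N.Decor π (fun x => Sum.elim (c (.inr ())) d (e.equiv x)) fun i => c (.inl i) := by
  refine (Linking.decor_map _ _ _).trans (iff_of_eq (congrArg _ ?_))
  funext x
  rcases x with x | x
  -- The image of `x` under `e` is not in constructor form, so the computation is done for arbitrary
  -- `z`, where a case split makes it definitional.
  · have key (z) : Sum.elim d (fun p => c p.1 p.2)
        ((((AtomFlow.sumComm _ _).sumCongr (AtomFlow.refl _)).trans <|
          (AtomFlow.sumAssoc _ _ _).trans <|
          (AtomFlow.refl _).sumCongr <|
          (AtomFlow.sumComm _ _).trans <|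
          ((AtomFlow.refl _).sumCongr (AtomFlow.sigmaUnit (cutTree A).leaf).symm).trans
          (AtomFlow.sigmaSum (fun C => (cutTree C).leaf) N.cut (fun _ : Unit => A)).symm).equiv
            (.inl z)) = Sum.elim (c (.inr ())) d z := by
      rcases z with z | z <;> rfl
    exact key (e.equiv x)
  · rfl

theorem decor_join (N : PreNet Γ) (M : PreNet Γ')
    (e : AtomFlow ((seqLeaf Γ).sum (seqLeaf Γ')) (seqLeaf Δ))
    (d : (seqLeaf Δ).carrier → Atom W)
    (c : (i : N.Cut ⊕ M.Cut) → (cutTree (Sum.elim N.cut M.cut i)).leaf.carrier → Atom W) :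
    (N.join M e).Decor π d c ↔
      N.Decor π (fun x => d (e.equiv (.inl x))) (fun i => c (.inl i)) ∧
      M.Decor π (fun x => d (e.equiv (.inr x))) (fun i => c (.inr i)) := by
  refine (Linking.decor_map _ _ _).trans ((Linking.decor_sum _ _ _).trans
    (and_congr (iff_of_eq (congrArg _ ?_)) (iff_of_eq (congrArg _ ?_))))
  all_goals
    funext x
    rcases x with x | x <;> rfl

theorem Decor.map_seqDeco {N : PreNet Γ} {d : (seqLeaf Γ).carrier → Atom W} {c}
    (h : N.Decor π d c) : (seqDeco Γ d).map (Formula.map π) = Γ :=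
  MLL.map_seqDeco π Γ d fun x => h.1 (.inl x)

theorem Decor.map_cutTree {N : PreNet Γ} {d : (seqLeaf Γ).carrier → Atom W} {c}
    (h : N.Decor π d c) (i : N.Cut) :
    ((cutTree (N.cut i)).deco (c i)).map π = cutTree (N.cut i) :=
  Formula.map_deco π _ _ fun x => h.1 (.inr ⟨i, x⟩)

variable (π) in
/-- Two nets with the same decorated conclusions and cuts are the same, if the decoration tells
their leaves apart. -/
theorem same_of_decor {N M : PreNet Γ} {d : (seqLeaf Γ).carrier → Atom W} {c c'}
    (hN : N.Decor π d c) (hM : M.Decor π d c') (hc : N.cutDeco c = M.cutDeco c')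
    (hinj : Function.Injective (Sum.elim d fun p : (cutLeaf N.cut).carrier => c p.1 p.2) ∨
      Function.Injective (Sum.elim d fun p : (cutLeaf M.cut).carrier => c' p.1 p.2)) :
    N.Same M := by
  obtain ⟨K, fK, cut, link⟩ := M
  obtain ⟨(e : K ≃ N.Cut), (he : ∀ k : K, _ = (cutTree (cut k)).deco (c' k))⟩ :=
    exists_equiv_of_famDeco_eq hc
  refine ⟨e, ?_⟩
  -- Forgetting the tags recovers the whole cut tree, and its left half is the cut formula.
  have hcut : cut = fun k => N.cut (e k) := by
    funext k
    have := congrArg (Formula.map π) (he k)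
    rw [hN.map_cutTree] at this
    exact (Formula.tens.inj (this.trans (hM.map_cutTree k))).1.symm
  subst hcut
  have hc' : c' = fun k => c (e k) := by
    funext k
    exact (Formula.deco_injective _ (he k)).symm
  subst hc'
  unfold reindex
  congr 1
  have hM' : link.Decor π _ := hM
  set τ := (AtomFlow.refl (seqLeaf Γ)).sumCongr
    (AtomFlow.sigmaReindex (fun i => (cutTree (N.cut i)).leaf) e)
  have hτ (x) : Sum.elim d (fun p : (k : K) × (cutTree (N.cut (e k))).leaf.carrier =>
      c (e p.1) p.2) x = Sum.elim d (fun p : (cutLeaf N.cut).carrier => c p.1 p.2)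
        (τ.equiv.symm x) := by
    rcases x with x | ⟨i, x⟩ <;> rfl
  -- The two decorations differ only by the renaming `τ` of the cuts, so it does not matter for
  -- which net injectivity was given.
  replace hinj : Function.Injective
      (Sum.elim d fun p : (cutLeaf N.cut).carrier => c p.1 p.2) := by
    refine hinj.elim id fun h x y hxy => τ.equiv.injective (h ((hτ _).trans ?_))
    refine Eq.trans ?_ (hτ _).symm
    exact (congrArg _ (τ.equiv.symm_apply_apply x)).trans
      (hxy.trans (congrArg _ (τ.equiv.symm_apply_apply y).symm))
  -- Both candidates for the partner of `x` carry the dual of the label of `x`, hence they coincide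
  -- by injectivity.
  have hp : link.partner = (N.link.map τ).partner := by
    funext x
    apply τ.equiv.symm.injective
    apply hinj
    refine (hτ _).symm.trans ((hM'.2 x).trans ?_)
    exact (congrArg Atom.dual (hτ x)).trans ((hN.2 _).symm.trans
      (congrArg (Sum.elim d fun p : (cutLeaf N.cut).carrier => c p.1 p.2)
        (τ.equiv.symm_apply_apply _).symm))
  obtain ⟨partner, _, _⟩ := link
  change partner = _ at hp
  subst hp
  rfl

end PreNet

end DecoratedNets

/-! ### Cut-free provability -/

section Prov

variable {V : Type u} {W : Type v}

/-- Cut-free provability of multisets of formulas, with atomic identity axioms. -/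
inductive Prov : Multiset (Formula W) → Prop
  | id (x : Atom W) : Prov (.atom x.dual ::ₘ {.atom x})
  | par {A B : Formula W} {Γ : Multiset (Formula W)} :
      Prov (A ::ₘ B ::ₘ Γ) → Prov (A.par B ::ₘ Γ)
  | tens {A B : Formula W} {Γ Δ : Multiset (Formula W)} :
      Prov (A ::ₘ Γ) → Prov (B ::ₘ Δ) → Prov (A.tens B ::ₘ (Γ + Δ))

namespace Prov

theorem cast {Γ Δ : Multiset (Formula W)} (h : Prov Γ) (e : Γ = Δ) : Prov Δ := e ▸ h

/-- Either the last rule introduces this ⅋, or it acts on another formula and the inversion moves up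
into the premise that contains the ⅋. Axioms are atomic and cannot contain it. -/
theorem par_inv {A B : Formula W} {Γ : Multiset (Formula W)} (h : Prov (A.par B ::ₘ Γ)) :
    Prov (A ::ₘ B ::ₘ Γ) := by
  generalize hm : A.par B ::ₘ Γ = m at h
  induction h generalizing Γ with
  | id x =>
    have : A.par B ∈ Formula.atom x.dual ::ₘ {Formula.atom x} := hm ▸ Multiset.mem_cons_self _ _
    simp at this
  | @par A' B' Γ' h ih =>
    rcases Multiset.cons_eq_cons.1 hm with ⟨h₁, rfl⟩ | ⟨-, Λ, rfl, rfl⟩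
    · obtain ⟨rfl, rfl⟩ := Formula.par.inj h₁
      exact h
    · have := ih (Γ := A' ::ₘ B' ::ₘ Λ) (by
        simp only [← Multiset.singleton_add]; abel)
      refine (Prov.par (A := A') (B := B') (Γ := A ::ₘ B ::ₘ Λ) (this.cast ?_)).cast ?_ <;>
      · simp only [← Multiset.singleton_add]; abel
  | @tens A' B' Γ' Δ' h h' ih ih' =>
    rcases Multiset.cons_eq_cons.1 hm with ⟨h₁, -⟩ | ⟨-, Λ, rfl, hs⟩
    · cases h₁
    · have hmem : A.par B ∈ Γ' + Δ' := hs ▸ Multiset.mem_cons_self _ _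
      rcases Multiset.mem_add.1 hmem with hmem | hmem
      · obtain ⟨Γ₁, rfl⟩ := Multiset.exists_cons_of_mem hmem
        rw [Multiset.cons_add, Multiset.cons_inj_right] at hs
        subst hs
        have := ih (Γ := A' ::ₘ Γ₁) (Multiset.cons_swap _ _ _)
        refine (Prov.tens (A := A') (Γ := A ::ₘ B ::ₘ Γ₁) (this.cast ?_) h').cast ?_ <;>
        · simp only [← Multiset.singleton_add]; abel
      · obtain ⟨Γ₁, rfl⟩ := Multiset.exists_cons_of_mem hmem
        rw [Multiset.add_cons, Multiset.cons_inj_right] at hs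
        subst hs
        have := ih' (Γ := B' ::ₘ Γ₁) (Multiset.cons_swap _ _ _)
        refine (Prov.tens (B := B') (Δ := A ::ₘ B ::ₘ Γ₁) h (this.cast ?_)).cast ?_ <;>
        · simp only [← Multiset.singleton_add]; abel

/-- To transform a proof of `A ⊗ B, Γ` it suffices to transform the `⊗`-rule with conclusion
`A ⊗ B`. -/
theorem tens_elim {A B : Formula W} {Γ : Multiset (Formula W)} (h : Prov (A.tens B ::ₘ Γ))
    (K : Multiset (Formula W))
    (H : ∀ Γ₁ Γ₂, Prov (A ::ₘ Γ₁) → Prov (B ::ₘ Γ₂) → Prov (K + (Γ₁ + Γ₂))) :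
    Prov (K + Γ) := by
  generalize hm : A.tens B ::ₘ Γ = m at h
  induction h generalizing Γ with
  | id x =>
    have : A.tens B ∈ Formula.atom x.dual ::ₘ {Formula.atom x} := hm ▸ Multiset.mem_cons_self _ _
    simp at this
  | @par A' B' Γ' h ih =>
    rcases Multiset.cons_eq_cons.1 hm with ⟨h₁, -⟩ | ⟨-, Λ, rfl, rfl⟩
    · cases h₁
    · have := ih (Γ := A' ::ₘ B' ::ₘ Λ) (by
        simp only [← Multiset.singleton_add]; abel)
      refine (Prov.par (A := A') (B := B') (Γ := K + Λ) (this.cast ?_)).cast ?_ <;>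
      · simp only [← Multiset.singleton_add]; abel
  | @tens A' B' Γ' Δ' h h' ih ih' =>
    rcases Multiset.cons_eq_cons.1 hm with ⟨h₁, rfl⟩ | ⟨-, Λ, rfl, hs⟩
    · obtain ⟨rfl, rfl⟩ := Formula.tens.inj h₁
      exact H _ _ h h'
    · have hmem : A.tens B ∈ Γ' + Δ' := hs ▸ Multiset.mem_cons_self _ _
      rcases Multiset.mem_add.1 hmem with hmem | hmem
      · obtain ⟨Γ₁, rfl⟩ := Multiset.exists_cons_of_mem hmem
        rw [Multiset.cons_add, Multiset.cons_inj_right] at hs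
        subst hs
        have := ih (Γ := A' ::ₘ Γ₁) (Multiset.cons_swap _ _ _)
        refine (Prov.tens (A := A') (Γ := K + Γ₁) (this.cast ?_) h').cast ?_ <;>
        · simp only [← Multiset.singleton_add]; abel
      · obtain ⟨Γ₁, rfl⟩ := Multiset.exists_cons_of_mem hmem
        rw [Multiset.add_cons, Multiset.cons_inj_right] at hs
        subst hs
        have := ih' (Γ := B' ::ₘ Γ₁) (Multiset.cons_swap _ _ _)
        refine (Prov.tens (B := B') (Δ := K + Γ₁) h (this.cast ?_)).cast ?_ <;>
        · simp only [← Multiset.singleton_add]; abel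

theorem identity (A : Formula W) : Prov (A.dual ::ₘ {A}) := by
  induction A with
  | atom x => exact .id x
  | par A B hA hB =>
    have h := Prov.tens (Γ := {B}) (Δ := {A}) hB hA
    have h' : Prov (A ::ₘ B ::ₘ {B.dual.tens A.dual}) := by
      refine h.cast ?_
      simp only [← Multiset.singleton_add]; abel
    exact h'.par.cast (Multiset.cons_swap _ _ _)
  | tens A B hA hB =>
    have h := Prov.tens (Γ := {A.dual}) (Δ := {B.dual})
      (hA.cast (Multiset.cons_swap _ _ _)) (hB.cast (Multiset.cons_swap _ _ _))
    have h' : Prov (B.dual ::ₘ A.dual ::ₘ {A.tens B}) := by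
      refine h.cast ?_
      simp only [← Multiset.singleton_add]; abel
    exact h'.par

/-- Provable transformations of a formula can be applied inside a context. -/
theorem deep {X Y : Formula W} {Θ : Multiset (Formula W)}
    (H : ∀ Γ, Prov (X ::ₘ Γ) → Prov (Y ::ₘ (Θ + Γ))) (S : Ctx W) :
    ∀ Γ, Prov (S.fill X ::ₘ Γ) → Prov (S.fill Y ::ₘ (Θ + Γ)) := by
  induction S with
  | hole => exact H
  | parL S B ih =>
    intro Γ h
    exact ((ih _ h.par_inv).cast (by rw [Multiset.add_cons])).par
  | parR A S ih =>
    intro Γ h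
    refine Prov.par ((ih (A ::ₘ Γ) (h.par_inv.cast (Multiset.cons_swap _ _ _))).cast ?_)
    rw [Multiset.add_cons, Multiset.cons_swap]
  | tensL S B ih =>
    intro Γ h
    refine (h.tens_elim ((S.fill Y).tens B ::ₘ Θ) fun Γ₁ Γ₂ h₁ h₂ => ?_).cast
      (Multiset.cons_add _ _ _)
    refine (Prov.tens (ih _ h₁) h₂).cast ?_
    simp only [← Multiset.singleton_add]; abel
  | tensR A S ih =>
    intro Γ h
    refine (h.tens_elim (A.tens (S.fill Y) ::ₘ Θ) fun Γ₁ Γ₂ h₁ h₂ => ?_).cast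
      (Multiset.cons_add _ _ _)
    refine (Prov.tens h₁ (ih _ h₂)).cast ?_
    simp only [← Multiset.singleton_add]; abel

end Prov

/-- The rules of the calculus of structures that rearrange atoms only, without their context. -/
inductive Shuffle : Formula W → Formula W → Prop
  | comDown (A B : Formula W) : Shuffle (A.par B) (B.par A)
  | comUp (A B : Formula W) : Shuffle (A.tens B) (B.tens A)
  | assDown (A B C : Formula W) : Shuffle (A.par (B.par C)) ((A.par B).par C)
  | assUp (A B C : Formula W) : Shuffle (A.tens (B.tens C)) ((A.tens B).tens C)
  | switch (A B C : Formula W) : Shuffle (A.tens (B.par C)) ((A.tens B).par C)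

/-- Decompose the old connectives with `par_inv` and `tens_elim`, then rebuild the new ones. For
switch, opening B ⅋ C in the second premise lets A be tensored with B alone, while C stays in the
sequent. -/
theorem Prov.shuffle {X Y : Formula W} (s : Shuffle X Y) (Γ : Multiset (Formula W))
    (h : Prov (X ::ₘ Γ)) : Prov (Y ::ₘ Γ) := by
  cases s with
  | comDown A B => exact (h.par_inv.cast (Multiset.cons_swap _ _ _)).par
  | comUp A B =>
    refine (h.tens_elim {B.tens A} fun Γ₁ Γ₂ h₁ h₂ => ?_).cast (Multiset.singleton_add _ _)
    exact (h₂.tens h₁).cast (by simp only [← Multiset.singleton_add]; abel)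
  | assDown A B C =>
    have := (h.par_inv.cast (Multiset.cons_swap _ _ _)).par_inv
    have h' : Prov (A ::ₘ B ::ₘ C ::ₘ Γ) := this.cast (by
      simp only [← Multiset.singleton_add]; abel)
    exact h'.par.par
  | assUp A B C =>
    refine (h.tens_elim {(A.tens B).tens C} fun Γ₁ Γ₂ h₁ h₂ => ?_).cast
      (Multiset.singleton_add _ _)
    refine (h₂.tens_elim ((A.tens B).tens C ::ₘ Γ₁) fun Δ₁ Δ₂ k₁ k₂ => ?_).cast
      (by simp only [← Multiset.singleton_add]; abel)
    exact ((h₁.tens k₁).tens k₂).cast (by simp only [← Multiset.singleton_add]; abel)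
  | switch A B C =>
    refine (h.tens_elim {(A.tens B).par C} fun Γ₁ Γ₂ h₁ h₂ => ?_).cast (Multiset.singleton_add _ _)
    have h' : Prov (A.tens B ::ₘ C ::ₘ (Γ₁ + Γ₂)) := (h₁.tens h₂.par_inv).cast (by
      simp only [← Multiset.singleton_add]; abel)
    exact h'.par.cast (Multiset.singleton_add _ _).symm

theorem Prov.shuffle_deep {X Y : Formula W} (s : Shuffle X Y) (S : Ctx W)
    (Γ : Multiset (Formula W)) (h : Prov (S.fill X ::ₘ Γ)) : Prov (S.fill Y ::ₘ Γ) := by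
  simpa using Prov.deep (Θ := 0) (fun Γ h => by simpa using Prov.shuffle s Γ h) S Γ h

/-- A^⊥ ⅋ A is provable with no side formulas, so tensoring with it adds nothing to the sequent. -/
theorem Prov.idown (S : Ctx W) (A B : Formula W) (Γ : Multiset (Formula W))
    (h : Prov (S.fill B ::ₘ Γ)) : Prov (S.fill ((A.dual.par A).tens B) ::ₘ Γ) := by
  have hA : Prov (A.dual.par A ::ₘ 0) := (Prov.identity A).par
  simpa using Prov.deep (Θ := 0) (fun Γ h => by simpa using hA.tens h) S Γ h

/-- Opening B ⅋ C releases C, which falls out of the context and becomes a separate member of the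
sequent. This is the use of a nonempty `Θ` in `Prov.deep`. -/
theorem Prov.iup (S : Ctx W) (B C : Formula W) (Γ : Multiset (Formula W))
    (h : Prov (S.fill (B.par C) ::ₘ Γ)) : Prov (S.fill B ::ₘ C ::ₘ Γ) := by
  simpa using Prov.deep (Θ := {C}) (fun Γ h => by simpa using h.par_inv) S Γ h

/-! ### Decorated derivations in the calculus of structures -/

/-- `A` is the conclusion of a decorated cut. -/
def IsCut (π : W → V) (C : Formula W) : Prop :=
  ∃ A A' : Formula W, C = A.tens A' ∧ A'.map π = (A.map π).dual

/-- Provability in the calculus of structures for decorated formulas, with a given multiset of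
cuts. -/
inductive DCos (π : W → V) : Formula W → Multiset (Formula W) → Prop
  | id (A : Formula W) : DCos π (A.dual.par A) 0
  | idown (S : Ctx W) (A B : Formula W) {E : Multiset (Formula W)} :
      DCos π (S.fill B) E → DCos π (S.fill ((A.dual.par A).tens B)) E
  | iup (S : Ctx W) (B C : Formula W) {E : Multiset (Formula W)} (hC : IsCut π C) :
      DCos π (S.fill (B.par C)) E → DCos π (S.fill B) (C ::ₘ E)
  | shuffle (S : Ctx W) {X Y : Formula W} {E : Multiset (Formula W)} (s : Shuffle X Y) :
      DCos π (S.fill X) E → DCos π (S.fill Y) E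

/-! ### Rewriting with the rules that only move atoms -/

/-- Composition of contexts. -/
def Ctx.comp : Ctx W → Ctx W → Ctx W
  | .hole, T => T
  | .parL S B, T => .parL (S.comp T) B
  | .parR A S, T => .parR A (S.comp T)
  | .tensL S B, T => .tensL (S.comp T) B
  | .tensR A S, T => .tensR A (S.comp T)

theorem Ctx.fill_comp (S T : Ctx W) (X : Formula W) :
    (S.comp T).fill X = S.fill (T.fill X) := by
  induction S <;> simp_all [Ctx.comp, Ctx.fill]

/-- `X` can be rewritten to `Y` by rules that rearrange atoms only. -/
inductive Rew : Formula W → Formula W → Prop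
  | refl (X : Formula W) : Rew X X
  | tail {X : Formula W} (S : Ctx W) {Y Z : Formula W} :
      Rew X (S.fill Y) → Shuffle Y Z → Rew X (S.fill Z)

namespace Rew

theorem of_shuffle {X Y : Formula W} (h : Shuffle X Y) : Rew X Y :=
  .tail .hole (.refl X) h

theorem trans {X Y Z : Formula W} (h : Rew X Y) (h' : Rew Y Z) : Rew X Z := by
  induction h' with
  | refl => exact h
  | tail S _ s ih => exact ih.tail S s

theorem fill {X Y : Formula W} (h : Rew X Y) (S : Ctx W) : Rew (S.fill X) (S.fill Y) := by
  induction h with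
  | refl => exact .refl _
  | tail T _ s ih =>
    rw [← Ctx.fill_comp] at ih ⊢
    exact ih.tail _ s

theorem par {X X' Y Y' : Formula W} (h : Rew X X') (h' : Rew Y Y') :
    Rew (X.par Y) (X'.par Y') :=
  (h.fill (.parL .hole Y)).trans (h'.fill (.parR X' .hole))

theorem tens {X X' Y Y' : Formula W} (h : Rew X X') (h' : Rew Y Y') :
    Rew (X.tens Y) (X'.tens Y') :=
  (h.fill (.tensL .hole Y)).trans (h'.fill (.tensR X' .hole))

theorem par_comm (X Y : Formula W) : Rew (X.par Y) (Y.par X) := of_shuffle (.comDown X Y)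

theorem tens_comm (X Y : Formula W) : Rew (X.tens Y) (Y.tens X) := of_shuffle (.comUp X Y)

theorem par_assoc' (X Y Z : Formula W) : Rew (X.par (Y.par Z)) ((X.par Y).par Z) :=
  of_shuffle (.assDown X Y Z)

/-- Only the other direction of associativity is a rule; this one is obtained by conjugating it with
commutativity. -/
theorem par_assoc (X Y Z : Formula W) : Rew ((X.par Y).par Z) (X.par (Y.par Z)) :=
  (par_comm _ _).trans <| (par_assoc' Z X Y).trans <| ((par_comm Z X).par (.refl Y)).trans <|
    (par_comm _ _).trans <| (par_assoc' Y X Z).trans <| ((par_comm Y X).par (.refl Z)).trans <|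
    (par_comm _ _).trans <| (par_assoc' Z X Y).trans <| (par_comm _ _).trans <|
    (par_assoc' Y Z X).trans (par_comm _ _)

theorem switch (X Y Z : Formula W) : Rew (X.tens (Y.par Z)) ((X.tens Y).par Z) :=
  of_shuffle (.switch X Y Z)

theorem switch' (X Y Z : Formula W) : Rew ((Y.par Z).tens X) ((Y.tens X).par Z) :=
  (tens_comm _ _).trans ((switch X Y Z).trans ((tens_comm X Y).par (.refl Z)))

theorem dcos {π : W → V} {X Y : Formula W} {E : Multiset (Formula W)} (h : Rew X Y)
    (hX : DCos π X E) : DCos π Y E := by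
  induction h with
  | refl => exact hX
  | tail S _ s ih => exact ih.shuffle S s

end Rew

/-- `F` is a `⅋` of the members of a multiset of formulas. -/
inductive ParM : Multiset (Formula W) → Formula W → Prop
  | single (A : Formula W) : ParM {A} A
  | par {Γ Δ : Multiset (Formula W)} {F G : Formula W} :
      ParM Γ F → ParM Δ G → ParM (Γ + Δ) (F.par G)

namespace ParM

theorem ne_zero {Γ : Multiset (Formula W)} {F : Formula W} (h : ParM Γ F) : Γ ≠ 0 := by
  induction h with
  | single A => simp
  | par _ _ ih _ => simp [ih]

theorem eq_of_singleton {A F : Formula W} (h : ParM {A} F) : F = A := by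
  generalize hm : ({A} : Multiset (Formula W)) = m at h
  cases h with
  | single B => exact (Multiset.singleton_inj.1 hm).symm
  | @par Γ Δ _ _ h h' =>
    have := congrArg Multiset.card hm
    have h₁ := Multiset.card_pos.2 h.ne_zero
    have h₂ := Multiset.card_pos.2 h'.ne_zero
    simp at this
    omega

theorem exists_of_ne_zero {Γ : Multiset (Formula W)} (h : Γ ≠ 0) : ∃ F, ParM Γ F := by
  induction Γ using Multiset.induction with
  | empty => exact absurd rfl h
  | cons A Γ ih =>
    by_cases h0 : Γ = 0
    · subst h0
      exact ⟨A, .single A⟩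
    · obtain ⟨F, hF⟩ := ih h0
      exact ⟨A.par F, .par (.single A) hF⟩

/-- Any member can be brought to the front. -/
theorem extract {A : Formula W} {Γ : Multiset (Formula W)} {F : Formula W}
    (h : ParM (A ::ₘ Γ) F) (hΓ : Γ ≠ 0) :
    ∃ G, ParM Γ G ∧ Rew F (A.par G) ∧ Rew (A.par G) F := by
  generalize hm : A ::ₘ Γ = m at h
  induction h generalizing Γ with
  | single B =>
    have := congrArg Multiset.card hm
    simp at this
    exact absurd this hΓ
  | @par Γ₁ Γ₂ F₁ F₂ h₁ h₂ ih₁ ih₂ =>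
    have hmem : A ∈ Γ₁ + Γ₂ := hm ▸ Multiset.mem_cons_self _ _
    rcases Multiset.mem_add.1 hmem with hmem | hmem
    · obtain ⟨Δ, rfl⟩ := Multiset.exists_cons_of_mem hmem
      rw [Multiset.cons_add, Multiset.cons_inj_right] at hm
      subst hm
      by_cases h0 : Δ = 0
      · subst h0
        obtain rfl := h₁.eq_of_singleton
        exact ⟨F₂, by simpa using h₂, .refl _, .refl _⟩
      · obtain ⟨G, hG, hr, hr'⟩ := ih₁ h0 rfl
        exact ⟨G.par F₂, hG.par h₂, (hr.par (.refl _)).trans (Rew.par_assoc _ _ _),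
          (Rew.par_assoc' _ _ _).trans (hr'.par (.refl _))⟩
    · obtain ⟨Δ, rfl⟩ := Multiset.exists_cons_of_mem hmem
      rw [Multiset.add_cons, Multiset.cons_inj_right] at hm
      subst hm
      by_cases h0 : Δ = 0
      · subst h0
        obtain rfl := h₂.eq_of_singleton
        exact ⟨F₁, by simpa using h₁, Rew.par_comm _ _, Rew.par_comm _ _⟩
      · obtain ⟨G, hG, hr, hr'⟩ := ih₂ h0 rfl
        refine ⟨F₁.par G, h₁.par hG, ?_, ?_⟩
        · exact ((Rew.refl _).par hr).trans <| (Rew.par_assoc' _ _ _).trans <|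
            ((Rew.par_comm _ _).par (.refl _)).trans (Rew.par_assoc _ _ _)
        · exact (Rew.par_assoc' _ _ _).trans <| ((Rew.par_comm _ _).par (.refl _)).trans <|
            (Rew.par_assoc _ _ _).trans ((Rew.refl _).par hr')

/-- Bring the same member to the front on both sides and recurse on the rest. Order and parentheses
of a large ⅋ are thus irrelevant in the calculus of structures. -/
theorem rew {Γ : Multiset (Formula W)} {F G : Formula W} (h : ParM Γ F) (h' : ParM Γ G) :
    Rew F G := by
  induction Γ using Multiset.induction generalizing F G with
  | empty => exact absurd rfl h.ne_zero
  | cons A Γ ih =>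
    by_cases h0 : Γ = 0
    · subst h0
      rw [h.eq_of_singleton, h'.eq_of_singleton]
      exact .refl _
    · obtain ⟨F', hF, hr, -⟩ := h.extract h0
      obtain ⟨G', hG, -, hr'⟩ := h'.extract h0
      exact hr.trans (((Rew.refl _).par (ih hF hG)).trans hr')

/-- The same `F` may be read with this ⅋ as one of its joining connectives. Hence the ⅋-rule of the
sequent calculus needs no inference step in the calculus of structures. -/
theorem par_inv {A B F : Formula W} {Γ : Multiset (Formula W)} (h : ParM (A.par B ::ₘ Γ) F) :
    ParM (A ::ₘ B ::ₘ Γ) F := by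
  generalize hm : A.par B ::ₘ Γ = m at h
  induction h generalizing Γ with
  | single C =>
    have hΓ : Γ = 0 := by simpa using congrArg Multiset.card hm
    subst hΓ
    obtain rfl := Multiset.singleton_inj.1 hm
    exact ParM.par (.single A) (.single B)
  | @par Γ₁ Γ₂ F₁ F₂ h₁ h₂ ih₁ ih₂ =>
    have hmem : A.par B ∈ Γ₁ + Γ₂ := hm ▸ Multiset.mem_cons_self _ _
    rcases Multiset.mem_add.1 hmem with hmem | hmem
    · obtain ⟨Δ, rfl⟩ := Multiset.exists_cons_of_mem hmem
      rw [Multiset.cons_add, Multiset.cons_inj_right] at hm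
      subst hm
      simpa using (ih₁ rfl).par h₂
    · obtain ⟨Δ, rfl⟩ := Multiset.exists_cons_of_mem hmem
      rw [Multiset.add_cons, Multiset.cons_inj_right] at hm
      subst hm
      simpa using h₁.par (ih₂ rfl)

/-- Switching a factor into a `⅋`. -/
theorem exists_rew_tens {A F X : Formula W} {Γ : Multiset (Formula W)} (h : ParM (A ::ₘ Γ) F) :
    ∃ G, ParM (A.tens X ::ₘ Γ) G ∧ Rew (F.tens X) G := by
  by_cases h0 : Γ = 0
  · subst h0
    obtain rfl := h.eq_of_singleton
    exact ⟨_, .single _, .refl _⟩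
  · obtain ⟨G, hG, hr, -⟩ := h.extract h0
    exact ⟨_, ParM.par (.single _) hG, (hr.tens (.refl X)).trans (Rew.switch' _ _ _)⟩

/-- Rewriting one member of a `⅋`. -/
theorem exists_rew {X Y F : Formula W} {Γ Δ : Multiset (Formula W)} (h : ParM (X ::ₘ Γ) F)
    (hr : Rew X Y) (hY : ParM Δ Y) : ∃ G, ParM (Δ + Γ) G ∧ Rew F G := by
  by_cases h0 : Γ = 0
  · subst h0
    obtain rfl := h.eq_of_singleton
    exact ⟨Y, by simpa using hY, hr⟩
  · obtain ⟨G, hG, hr', -⟩ := h.extract h0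
    exact ⟨_, hY.par hG, hr'.trans (hr.par (.refl _))⟩

end ParM

/-! ### From cut-free derivations to the calculus of structures -/

/-- Run the derivation of `Y` first, then that of `X` inside the context { } ⊗ Y. The initial i↓ of
`X` becomes a deep i↓ applied to `Y`. -/
theorem DCos.fill_tens {π : W → V} {X Y : Formula W} {E E' : Multiset (Formula W)}
    (hX : DCos π X E) (hY : DCos π Y E') : DCos π (X.tens Y) (E + E') := by
  induction hX with
  | id A =>
    rw [zero_add]
    exact DCos.idown .hole A Y hY
  | idown S A B _ ih => exact DCos.idown (.tensL S Y) A B ih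
  | iup S B C hC _ ih =>
    rw [Multiset.cons_add]
    exact DCos.iup (.tensL S Y) B C hC ih
  | shuffle S s _ ih => exact DCos.shuffle (.tensL S Y) s ih

theorem Prov.dcos (π : W → V) {Γ : Multiset (Formula W)} (h : Prov Γ) :
    ∀ F, ParM Γ F → DCos π F 0 := by
  induction h with
  | id x =>
    intro F hF
    exact ((ParM.single (Formula.atom x.dual)).par (.single (.atom x))).rew hF |>.dcos
      (DCos.id (.atom x))
  | par _ ih => exact fun F hF => ih F hF.par_inv
  | @tens A B Γ Δ _ _ ih₁ ih₂ =>
    intro F hF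
    obtain ⟨F₁, h₁⟩ := ParM.exists_of_ne_zero (Multiset.cons_ne_zero (a := A) (m := Γ))
    obtain ⟨F₂, h₂⟩ := ParM.exists_of_ne_zero (Multiset.cons_ne_zero (a := B) (m := Δ))
    -- Switch is used twice on `F₁` ⊗ `F₂`: first all of `F₂` is moved next to `A`, then `A` is
    -- moved next to `B` inside `F₂`.
    obtain ⟨G₁, hG₁, hr₁⟩ := h₁.exists_rew_tens (X := F₂)
    obtain ⟨G₂, hG₂, hr₂⟩ := h₂.exists_rew_tens (X := A)
    obtain ⟨G, hG, hr⟩ := hG₁.exists_rew ((Rew.tens_comm _ _).trans hr₂) hG₂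
    rw [Multiset.cons_add] at hG
    obtain ⟨G', hG', hr'⟩ := hG.exists_rew (Γ := Δ + Γ) (Rew.tens_comm B A) (.single _)
    have e : {A.tens B} + (Δ + Γ) = A.tens B ::ₘ (Γ + Δ) := by
      rw [Multiset.singleton_add, add_comm]
    rw [e] at hG'
    have := ((ih₁ _ h₁).fill_tens (ih₂ _ h₂))
    exact (hr₁.trans (hr.trans (hr'.trans (hG'.rew hF)))).dcos (by simpa using this)

/-- The tensors that stand for cuts are joined to `F` by outermost ⅋s, and i↑ in the empty context
removes them one at a time. -/
theorem DCos.cuts {π : W → V} (C : Multiset (Formula W)) :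
    ∀ {Γ E : Multiset (Formula W)} {F : Formula W}, (∀ A ∈ C, IsCut π A) → ParM Γ F →
      (∀ G, ParM (Γ + C) G → DCos π G E) → DCos π F (C + E) := by
  induction C using Multiset.induction with
  | empty =>
    intro Γ E F _ hF h
    simpa using h F (by simpa using hF)
  | cons A C ih =>
    intro Γ E F hC hF h
    have := ih (Γ := Γ + {A}) (E := E) (F := F.par A) (fun B hB => hC B (by simp [hB]))
      (hF.par (.single A)) fun G hG => h G (by
        rwa [add_assoc, Multiset.singleton_add] at hG)
    rw [Multiset.cons_add]
    exact DCos.iup .hole F A (hC A (by simp)) this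

end Prov

/-! ### Decorated sequent calculus proofs -/

section SeqProofs

variable {V : Type u} {W : Type v}

/-- Tracing is compatible with tagging, so the rule acts on the tagged sequents as an instance of
itself. The length of `l` is recorded to locate the active formulas when a tagged sequent is given
in advance; the same holds for the analogues for the other rules. -/
theorem seqDeco_exchFlow (Γ Δ : List (Formula V)) (A B : Formula V)
    (d : (seqLeaf (Γ ++ B :: A :: Δ)).carrier → Atom W) :
    ∃ l a b r, l.length = Γ.length ∧
      seqDeco (Γ ++ A :: B :: Δ) (fun x => d ((exchFlow Γ Δ A B).equiv x)) = l ++ a :: b :: r ∧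
      seqDeco (Γ ++ B :: A :: Δ) d = l ++ b :: a :: r :=
  ⟨_, _, _, _, length_seqDeco Γ _,
    seqDeco_append' Γ (A :: B :: Δ) fun z => d ((appendFlow Γ (B :: A :: Δ)).equiv.symm
      (((AtomFlow.refl (seqLeaf Γ)).sumCongr
        (AtomFlow.leftComm A.leaf B.leaf (seqLeaf Δ))).equiv z)),
    seqDeco_append Γ (B :: A :: Δ) d⟩

theorem seqDeco_parFlow (Γ Δ : List (Formula V)) (A B : Formula V)
    (d : (seqLeaf (Γ ++ A.par B :: Δ)).carrier → Atom W) :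
    ∃ l a b r, l.length = Γ.length ∧
      seqDeco (Γ ++ A :: B :: Δ) (fun x => d ((parFlow Γ Δ A B).equiv x)) = l ++ a :: b :: r ∧
      seqDeco (Γ ++ A.par B :: Δ) d = l ++ a.par b :: r :=
  ⟨_, _, _, _, length_seqDeco Γ _,
    seqDeco_append' Γ (A :: B :: Δ) fun z => d ((appendFlow Γ (A.par B :: Δ)).equiv.symm
      (((AtomFlow.refl (seqLeaf Γ)).sumCongr
        (AtomFlow.sumAssoc A.leaf B.leaf (seqLeaf Δ)).symm).equiv z)),
    seqDeco_append Γ (A.par B :: Δ) d⟩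

theorem seqDeco_snoc (Γ : List (Formula V)) (A : Formula V)
    (d : (seqLeaf Γ).carrier ⊕ A.leaf.carrier → Atom W) :
    seqDeco (Γ ++ [A]) (fun x => d ((snocFlow Γ A).equiv x)) =
      seqDeco Γ (fun x => d (.inl x)) ++ [A.deco fun x => d (.inr x)] :=
  seqDeco_append' Γ [A] fun z => d (((AtomFlow.refl (seqLeaf Γ)).sumCongr
    (AtomFlow.sumEmpty A.leaf)).equiv z)

theorem seqDeco_tensFlow (Γ Δ : List (Formula V)) (A B : Formula V)
    (d : (seqLeaf (Γ ++ A.tens B :: Δ)).carrier → Atom W) :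
    ∃ l a b r, l.length = Γ.length ∧
      seqDeco (Γ ++ [A]) (fun x => d ((tensFlow Γ Δ A B).equiv (.inl x))) = l ++ [a] ∧
      seqDeco (B :: Δ) (fun x => d ((tensFlow Γ Δ A B).equiv (.inr x))) = b :: r ∧
      seqDeco (Γ ++ A.tens B :: Δ) d = l ++ a.tens b :: r :=
  ⟨_, _, _, _, length_seqDeco Γ _,
    seqDeco_snoc Γ A fun z => d ((appendFlow Γ (A.tens B :: Δ)).equiv.symm
      (((AtomFlow.refl (seqLeaf Γ)).sumCongr
        (AtomFlow.sumAssoc A.leaf B.leaf (seqLeaf Δ)).symm).equiv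
          ((AtomFlow.sumAssoc (seqLeaf Γ) A.leaf (B.leaf.sum (seqLeaf Δ))).equiv (.inl z)))),
    rfl, seqDeco_append Γ (A.tens B :: Δ) d⟩

theorem seqDeco_cutFlow (Γ Δ : List (Formula V)) (A : Formula V)
    (f : (cutTree A).leaf.carrier → Atom W) (d : (seqLeaf (Γ ++ Δ)).carrier → Atom W) :
    ∃ l r, l.length = Γ.length ∧
      seqDeco (Γ ++ [A]) (fun x => Sum.elim f d ((cutFlow Γ Δ A).equiv
        ((appendFlow (Γ ++ [A]) (A.dual :: Δ)).symm.equiv (.inl x)))) =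
          l ++ [A.deco fun x => f (.inl x)] ∧
      seqDeco (A.dual :: Δ) (fun x => Sum.elim f d ((cutFlow Γ Δ A).equiv
        ((appendFlow (Γ ++ [A]) (A.dual :: Δ)).symm.equiv (.inr x)))) =
          A.dual.deco (fun x => f (.inr x)) :: r ∧
      seqDeco (Γ ++ Δ) d = l ++ r := by
  -- This is `cutFlow` without its initial `appendFlow`, which cancels against the inverse one used
  -- to join the two premises.
  let e : AtomFlow ((seqLeaf (Γ ++ [A])).sum (A.dual.leaf.sum (seqLeaf Δ)))
      ((A.leaf.sum A.dual.leaf).sum (seqLeaf (Γ ++ Δ))) :=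
    (((snocFlow Γ A).trans (AtomFlow.sumComm _ _)).sumCongr (AtomFlow.refl _)).trans <|
      (AtomFlow.sumSumComm A.leaf (seqLeaf Γ) A.dual.leaf (seqLeaf Δ)).trans <|
      (AtomFlow.refl _).sumCongr (appendFlow Γ Δ).symm
  have he (z) : (cutFlow Γ Δ A).equiv ((appendFlow (Γ ++ [A]) (A.dual :: Δ)).symm.equiv z) =
      e.equiv z :=
    congrArg e.equiv ((appendFlow (Γ ++ [A]) (A.dual :: Δ)).equiv.apply_symm_apply z)
  refine ⟨_, _, length_seqDeco Γ _, ?_, ?_, seqDeco_append Γ Δ d⟩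
  · refine (congrArg _ (funext fun x => congrArg _ (he _))).trans ?_
    refine (seqDeco_snoc Γ A fun z => Sum.elim f d (((AtomFlow.refl _).sumCongr
      (appendFlow Γ Δ).symm).equiv ((AtomFlow.sumSumComm A.leaf (seqLeaf Γ) A.dual.leaf
        (seqLeaf Δ)).equiv (.inl ((AtomFlow.sumComm _ _).equiv z))))).trans ?_
    rfl
  · refine (congrArg _ (funext fun x => congrArg _ (he _))).trans ?_
    rfl

theorem PreNet.cutDeco_nil (c) : (PreNet.nil V).cutDeco (W := W) c = 0 :=
  haveI : IsEmpty (PreNet.nil V).Cut := inferInstanceAs (IsEmpty Empty)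
  famDeco_empty _

theorem PreNet.cutDeco_join {Γ Γ' Δ : List (Formula V)} (N : PreNet Γ) (M : PreNet Γ')
    (e : AtomFlow ((seqLeaf Γ).sum (seqLeaf Γ')) (seqLeaf Δ))
    (c : (i : N.Cut ⊕ M.Cut) → (cutTree (Sum.elim N.cut M.cut i)).leaf.carrier → Atom W) :
    (N.join M e).cutDeco c =
      N.cutDeco (fun i => c (.inl i)) + M.cutDeco (fun i => c (.inr i)) :=
  famDeco_sum _

theorem PreNet.cutDeco_addCut {Γ Δ : List (Formula V)} (N : PreNet Γ) (A : Formula V)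
    (e : AtomFlow (seqLeaf Γ) ((A.leaf.sum A.dual.leaf).sum (seqLeaf Δ)))
    (c : (i : N.Cut ⊕ Unit) → (cutTree (Sum.elim N.cut (fun _ => A) i)).leaf.carrier → Atom W) :
    (N.addCut A e).cutDeco c =
      (cutTree A).deco (c (.inr ())) ::ₘ N.cutDeco (fun i => c (.inl i)) :=
  (famDeco_sum _).trans <| by
    rw [famDeco_unit, add_comm, Multiset.singleton_add]
    rfl

/-- The decorated conclusions and cuts of the net of a sequent calculus proof are provable. -/
theorem SeqProof.prov {π : W → V} {Γ : List (Formula V)} (p : SeqProof Γ) :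
    ∀ d c, p.net.Decor π d c → Prov ((seqDeco Γ d : Multiset (Formula W)) + p.net.cutDeco c) := by
  induction p with
  | id A =>
    intro d c h
    have h' := ((PreNet.decor_addId _ _ _ _ _).1 h).1.2
    have hc : (SeqProof.id A).net.cutDeco c = 0 := PreNet.cutDeco_nil c
    rw [hc, add_zero]
    refine (Prov.identity (A.deco fun x => d (.inr (.inl x)))).cast ?_
    exact congrArg (· ::ₘ {A.deco fun x => d (.inr (.inl x))}) h'.symm
  | exch Γ Δ A B p ih =>
    intro d c h
    obtain ⟨l, a, b, r, -, h₁, h₂⟩ := seqDeco_exchFlow Γ Δ A B d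
    have := ih _ _ ((PreNet.decor_flow _ _ _ _).1 h)
    rw [h₁] at this
    rw [h₂]
    refine this.cast (congrArg₂ _ ?_ rfl)
    exact Multiset.coe_eq_coe.2 ((List.Perm.swap _ _ _).append_left l)
  | par Γ Δ A B p ih =>
    intro d c h
    obtain ⟨l, a, b, r, -, h₁, h₂⟩ := seqDeco_parFlow Γ Δ A B d
    have := ih _ _ ((PreNet.decor_flow _ _ _ _).1 h)
    rw [h₁] at this
    rw [h₂]
    have h₃ : Prov (a ::ₘ b ::ₘ ((l : Multiset (Formula W)) + r + p.net.cutDeco c)) :=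
      this.cast (by
        simp only [← Multiset.coe_add, ← Multiset.cons_coe, ← Multiset.singleton_add]; abel)
    refine h₃.par.cast ?_
    simp only [← Multiset.coe_add, ← Multiset.cons_coe, ← Multiset.singleton_add, add_assoc]
    rw [add_left_comm]
    rfl
  | tens Γ Δ A B p q ihp ihq =>
    intro d c h
    obtain ⟨l, a, b, r, -, h₁, h₂, h₃⟩ := seqDeco_tensFlow Γ Δ A B d
    obtain ⟨hp, hq⟩ := (PreNet.decor_join _ _ _ _ _).1 h
    have hp := ihp _ _ hp
    have hq := ihq _ _ hq
    have hp := hp.cast (congrArg (fun l : List _ => (l : Multiset (Formula W)) + _) h₁)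
    have hq := hq.cast (congrArg (fun l : List _ => (l : Multiset (Formula W)) + _) h₂)
    refine Prov.cast ?_ (congrArg (fun l : List _ => (l : Multiset (Formula W)) + _) h₃.symm)
    have := Prov.tens (A := a) (B := b) (Γ := (l : Multiset (Formula W)) + p.net.cutDeco _)
      (Δ := (r : Multiset (Formula W)) + q.net.cutDeco _)
      (hp.cast (by
        simp only [← Multiset.coe_add, Multiset.coe_singleton, ← Multiset.singleton_add]; abel))
      (hq.cast (by rw [← Multiset.cons_coe, Multiset.cons_add]; rfl))
    refine this.cast (Eq.trans ?_ (congrArg _ (PreNet.cutDeco_join _ _ _ _).symm))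
    simp only [← Multiset.coe_add, ← Multiset.cons_coe, ← Multiset.singleton_add]
    abel
  | cut Γ Δ A p q ihp ihq =>
    intro d c h
    obtain ⟨l, r, -, h₁, h₂, h₃⟩ := seqDeco_cutFlow Γ Δ A (c (.inr ())) d
    obtain ⟨hp, hq⟩ := (PreNet.decor_join _ _ _ _ _).1 ((PreNet.decor_addCut _ _ _ _ _).1 h)
    have hp := ihp _ _ hp
    have hq := ihq _ _ hq
    have hp := hp.cast (congrArg (fun l : List _ => (l : Multiset (Formula W)) + _) h₁)
    have hq := hq.cast (congrArg (fun l : List _ => (l : Multiset (Formula W)) + _) h₂)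
    refine Prov.cast ?_ (congrArg (fun l : List _ => (l : Multiset (Formula W)) + _) h₃.symm)
    -- The cut becomes a ⊗-rule whose principal formula is counted among the tagged cuts.
    have := Prov.tens (Γ := (l : Multiset (Formula W)) + p.net.cutDeco _)
      (Δ := (r : Multiset (Formula W)) + q.net.cutDeco _)
      (hp.cast (by
        simp only [← Multiset.coe_add, Multiset.coe_singleton, ← Multiset.singleton_add]; abel))
      (hq.cast (by rw [← Multiset.cons_coe, Multiset.cons_add]; rfl))
    refine this.cast (Eq.trans ?_ (congrArg _ ((PreNet.cutDeco_addCut _ _ _ _).trans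
      (congrArg _ (PreNet.cutDeco_join _ _ _ _))).symm))
    simp only [← Multiset.coe_add, ← Multiset.singleton_add]
    change {(cutTree A).deco (c (.inr ()))} + _ = _
    abel

/-! ### Transport of taggings through the operations on nets -/

namespace PreNet

variable {π : W → V} {Γ Γ' Δ : List (Formula V)}

theorem Decor.flow {N : PreNet Γ} (e : AtomFlow (seqLeaf Γ) (seqLeaf Δ))
    {d : (seqLeaf Γ).carrier → Atom W} {c} (h : N.Decor π d c) :
    (N.flow e).Decor π (fun y => d (e.equiv.symm y)) c := by
  rw [decor_flow]
  simpa using h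

theorem Decor.addId {N : PreNet Γ} (A : Formula V)
    (e : AtomFlow ((A.dual.leaf.sum A.leaf).sum (seqLeaf Γ)) (seqLeaf Δ))
    {d : (seqLeaf Γ).carrier → Atom W} {c} (h : N.Decor π d c)
    {f : A.leaf.carrier → Atom W} {f' : A.dual.leaf.carrier → Atom W}
    (hf : ∀ x, (f x).map π = A.leaf.lab x) (hf' : A.dual.deco f' = (A.deco f).dual) :
    (N.addId A e).Decor π (fun y => Sum.elim (Sum.elim f' f) d (e.equiv.symm y)) c := by
  rw [decor_addId]
  simp only [Equiv.symm_apply_apply]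
  exact ⟨⟨hf, hf'⟩, h⟩

theorem Decor.addCut {N : PreNet Γ} (A : Formula V)
    (e : AtomFlow (seqLeaf Γ) ((A.leaf.sum A.dual.leaf).sum (seqLeaf Δ)))
    {d : (seqLeaf Γ).carrier → Atom W} {c} (h : N.Decor π d c) :
    (N.addCut A e).Decor π (fun y => d (e.equiv.symm (.inr y)))
      (fun i => Sum.rec (motive := fun i => (cutTree (Sum.elim N.cut (fun _ => A) i)).leaf.carrier →
        Atom W) c (fun _ x => d (e.equiv.symm (.inl x))) i) := by
  refine (decor_addCut _ _ _ _ _).2 ?_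
  have hd : (fun x => Sum.elim (fun y => d (e.equiv.symm (.inl y)))
      (fun y => d (e.equiv.symm (.inr y))) (e.equiv x)) = d := by
    funext x
    conv_rhs => rw [← e.equiv.symm_apply_apply x]
    rcases e.equiv x with x | x <;> rfl
  exact (congrArg (fun f => N.Decor π f c) hd).mpr h

theorem Decor.join {N : PreNet Γ} {M : PreNet Γ'}
    (e : AtomFlow ((seqLeaf Γ).sum (seqLeaf Γ')) (seqLeaf Δ))
    {d : (seqLeaf Γ).carrier → Atom W} {c} (h : N.Decor π d c)
    {d' : (seqLeaf Γ').carrier → Atom W} {c'} (h' : M.Decor π d' c') :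
    (N.join M e).Decor π (fun y => Sum.elim d d' (e.equiv.symm y))
      (fun i => Sum.rec (motive := fun i => (cutTree (Sum.elim N.cut M.cut i)).leaf.carrier →
        Atom W) c c' i) := by
  refine (decor_join _ _ _ _ _).2 ?_
  simp only [Equiv.symm_apply_apply]
  exact ⟨h, h'⟩

end PreNet

/-- There is a sequent calculus proof whose net has the given decorated conclusions and cuts. -/
def RealSeq (π : W → V) (l : List (Formula W)) (C : Multiset (Formula W)) : Prop :=
  ∃ (Γ : List (Formula V)) (p : SeqProof Γ) (d : (seqLeaf Γ).carrier → Atom W)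
    (c : (i : p.net.Cut) → (cutTree (p.net.cut i)).leaf.carrier → Atom W),
    p.net.Decor π d c ∧ seqDeco Γ d = l ∧ p.net.cutDeco c = C

namespace RealSeq

variable {π : W → V}

/-- The untagged sequent is forced by the tagged one, so it may be taken in any form in which a rule
can be applied. -/
theorem exists_of_eq {l : List (Formula W)} {C : Multiset (Formula W)} (h : RealSeq π l C)
    {Γ : List (Formula V)} (hΓ : l.map (Formula.map π) = Γ) :
    ∃ (p : SeqProof Γ) (d : (seqLeaf Γ).carrier → Atom W)
    (c : (i : p.net.Cut) → (cutTree (p.net.cut i)).leaf.carrier → Atom W),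
    p.net.Decor π d c ∧ seqDeco Γ d = l ∧ p.net.cutDeco c = C := by
  obtain ⟨Γ', p, d, c, hd, rfl, hC⟩ := h
  rw [hd.map_seqDeco] at hΓ
  subst hΓ
  exact ⟨p, d, c, hd, rfl, hC⟩

theorem id (x : Atom W) : RealSeq π [.atom x.dual, .atom x] 0 := by
  refine ⟨_, .id (.atom (x.map π)), _, _, PreNet.Decor.addId (W := W) _ _
    (PreNet.decor_nil (fun x => x.elim) (fun i => i.elim)) (f := fun _ => x)
    (f' := fun _ => x.dual) (fun _ => rfl) rfl, rfl, PreNet.cutDeco_nil _⟩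

theorem exch {l r : List (Formula W)} {a b : Formula W} {C : Multiset (Formula W)}
    (h : RealSeq π (l ++ a :: b :: r) C) : RealSeq π (l ++ b :: a :: r) C := by
  obtain ⟨p, d, c, hd, hl, hC⟩ := h.exists_of_eq List.map_append
  refine ⟨_, .exch _ _ _ _ p, _, c, hd.flow _, ?_, hC⟩
  obtain ⟨l', a', b', r', hlen, h₁, h₂⟩ := seqDeco_exchFlow (l.map (Formula.map π))
    (r.map (Formula.map π)) (a.map π) (b.map π) fun y => d ((exchFlow _ _ _ _).equiv.symm y)
  simp only [Equiv.symm_apply_apply] at h₁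
  -- Two splittings of the same list with left parts of equal length agree.
  have h₃ := List.append_inj (hl.symm.trans h₁) (by rw [hlen, List.length_map])
  simp only [List.cons.injEq] at h₃
  obtain ⟨rfl, rfl, rfl, rfl⟩ := h₃
  exact h₂

theorem par {l r : List (Formula W)} {a b : Formula W} {C : Multiset (Formula W)}
    (h : RealSeq π (l ++ a :: b :: r) C) : RealSeq π (l ++ a.par b :: r) C := by
  obtain ⟨p, d, c, hd, hl, hC⟩ := h.exists_of_eq List.map_append
  refine ⟨_, .par _ _ _ _ p, _, c, hd.flow _, ?_, hC⟩
  obtain ⟨l', a', b', r', hlen, h₁, h₂⟩ := seqDeco_parFlow (l.map (Formula.map π))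
    (r.map (Formula.map π)) (a.map π) (b.map π) fun y => d ((parFlow _ _ _ _).equiv.symm y)
  simp only [Equiv.symm_apply_apply] at h₁
  have h₃ := List.append_inj (hl.symm.trans h₁) (by rw [hlen, List.length_map])
  simp only [List.cons.injEq] at h₃
  obtain ⟨rfl, rfl, rfl, rfl⟩ := h₃
  exact h₂

theorem tens {l r : List (Formula W)} {a b : Formula W} {C C' : Multiset (Formula W)}
    (h : RealSeq π (l ++ [a]) C) (h' : RealSeq π (b :: r) C') :
    RealSeq π (l ++ a.tens b :: r) (C + C') := by
  obtain ⟨p, d, c, hd, hl, hC⟩ := h.exists_of_eq List.map_append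
  obtain ⟨q, d', c', hd', hl', hC'⟩ := h'.exists_of_eq List.map_cons
  refine ⟨_, .tens _ _ _ _ p q, _, _, hd.join _ hd', ?_, ?_⟩
  · obtain ⟨l₁, a₁, b₁, r₁, hlen, h₁, h₂, h₃⟩ := seqDeco_tensFlow (l.map (Formula.map π))
      (r.map (Formula.map π)) (a.map π) (b.map π)
      fun y => Sum.elim d d' ((tensFlow _ _ _ _).equiv.symm y)
    simp only [Equiv.symm_apply_apply, Sum.elim_inl, Sum.elim_inr] at h₁ h₂
    have h₄ := List.append_inj (hl.symm.trans h₁) (by rw [hlen, List.length_map])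
    have h₅ := hl'.symm.trans h₂
    simp only [List.cons.injEq, and_true] at h₄ h₅
    obtain ⟨rfl, rfl⟩ := h₄
    obtain ⟨rfl, rfl⟩ := h₅
    exact h₃
  · exact (PreNet.cutDeco_join _ _ _ _).trans (congrArg₂ _ hC hC')

theorem cut {l r : List (Formula W)} {a a' : Formula W} {C C' : Multiset (Formula W)}
    (ha : a'.map π = (a.map π).dual)
    (h : RealSeq π (l ++ [a]) C) (h' : RealSeq π (a' :: r) C') :
    RealSeq π (l ++ r) (a.tens a' ::ₘ (C + C')) := by
  obtain ⟨p, d, c, hd, hl, hC⟩ := h.exists_of_eq List.map_append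
  obtain ⟨q, d', c', hd', hl', hC'⟩ := h'.exists_of_eq
    (Γ := (a.map π).dual :: r.map (Formula.map π)) (by rw [List.map_cons, ha])
  -- The taggings of the two premises, carried along the flows to the leaves of the new cut and of
  -- the conclusion.
  let D := fun z => Sum.elim d d' ((appendFlow _ _).symm.equiv.symm
    ((cutFlow (l.map (Formula.map π)) (r.map (Formula.map π)) (a.map π)).equiv.symm z))
  obtain ⟨l₁, r₁, hlen, h₁, h₂, h₃⟩ := seqDeco_cutFlow (l.map (Formula.map π))
    (r.map (Formula.map π)) (a.map π) (fun y => D (.inl y)) (fun y => D (.inr y))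
  have hD (z) : Sum.elim (fun y => D (.inl y)) (fun y => D (.inr y))
      ((cutFlow (l.map (Formula.map π)) (r.map (Formula.map π)) (a.map π)).equiv
        ((appendFlow _ _).symm.equiv z)) = Sum.elim d d' z := by
    have hs (y) : Sum.elim (fun y => D (.inl y)) (fun y => D (.inr y)) y = D y := by
      rcases y with y | y <;> rfl
    exact (hs _).trans (congrArg (Sum.elim d d')
      ((congrArg _ (Equiv.symm_apply_apply _ _)).trans (Equiv.symm_apply_apply _ _)))
  have h₄ := List.append_inj (hl.symm.trans
    ((congrArg (seqDeco _) (funext fun x => hD (.inl x))).symm.trans h₁))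
    (by rw [hlen, List.length_map])
  have h₅ := hl'.symm.trans ((congrArg (seqDeco _) (funext fun x => hD (.inr x))).symm.trans h₂)
  simp only [List.cons.injEq, and_true] at h₄ h₅
  obtain ⟨rfl, ha₁⟩ := h₄
  obtain ⟨ha₂, rfl⟩ := h₅
  refine ⟨_, .cut _ _ _ p q, _, _, (hd.join _ hd').addCut _ _, h₃, ?_⟩
  exact (PreNet.cutDeco_addCut _ _ _ _).trans (congrArg₂ _
    (congrArg₂ Formula.tens ha₁.symm ha₂.symm)
    ((PreNet.cutDeco_join _ _ _ _).trans (congrArg₂ _ hC hC')))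

theorem perm {l l' : List (Formula W)} {C : Multiset (Formula W)} (hl : l.Perm l')
    (h : RealSeq π l C) : RealSeq π l' C := by
  -- An arbitrary prefix is needed because the congruence case of a permutation exchanges formulas
  -- behind a fixed head.
  suffices H : ∀ k, RealSeq π (k ++ l) C → RealSeq π (k ++ l') C from H [] h
  clear h
  induction hl with
  | nil => exact fun _ h => h
  | cons a _ ih =>
    intro k h
    simpa using ih (k ++ [a]) (by simpa using h)
  | swap a b l => exact fun k h => h.exch
  | trans _ _ ih ih' => exact fun k h => ih' k (ih k h)

end RealSeq

/-! ### From cut-free derivations to sequent calculus proofs -/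

theorem exists_add_of_add_eq {α : Type*} {Γ Δ C : Multiset α} {l : List α}
    (h : Γ + Δ = (l : Multiset α) + C) :
    ∃ (l₁ l₂ : List α) (C₁ C₂ : Multiset α), Γ = l₁ + C₁ ∧ Δ = l₂ + C₂ ∧
      (l : Multiset α) = ↑(l₁ ++ l₂) ∧ C = C₁ + C₂ := by
  classical
  -- `Γ` takes as many members of `C` as it can; the others necessarily lie in `Δ`.
  refine ⟨(Γ - C ∩ Γ).toList, (Δ - (C - C ∩ Γ)).toList, C ∩ Γ, C - C ∩ Γ, ?_⟩
  rw [← Multiset.coe_add]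
  simp only [Multiset.coe_toList]
  have hc (a : α) := congrArg (Multiset.count a) h
  simp only [Multiset.count_add] at hc
  refine ⟨?_, ?_, ?_, ?_⟩ <;> ext a <;> specialize hc a <;>
    simp only [Multiset.count_add, Multiset.count_sub, Multiset.count_inter] <;> omega

/-- Members of `C` are tensors, so an axiom has none of them and a principal ⅋ belongs to the
sequent. A principal tensor gives a ⊗-rule if it is found in `l` and a cut if it is found in `C`. -/
theorem Prov.realSeq {π : W → V} {m : Multiset (Formula W)} (h : Prov m) :
    ∀ (l : List (Formula W)) (C : Multiset (Formula W)), m = (l : Multiset (Formula W)) + C →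
      (∀ A ∈ C, IsCut π A) → RealSeq π l C := by
  induction h with
  | id x =>
    intro l C hm hC
    have hC0 : C = 0 := by
      refine Multiset.eq_zero_of_forall_notMem fun A hA => ?_
      obtain ⟨B, B', rfl, -⟩ := hC A hA
      have : B.tens B' ∈ Formula.atom x.dual ::ₘ {Formula.atom x} :=
        hm ▸ Multiset.mem_add.2 (.inr hA)
      simp at this
    subst hC0
    rw [add_zero] at hm
    exact (RealSeq.id x).perm (Multiset.coe_eq_coe.1 hm)
  | @par A B Γ h ih =>
    intro l C hm hC
    have hmem : A.par B ∈ (l : Multiset (Formula W)) := by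
      have : A.par B ∈ (l : Multiset (Formula W)) + C := hm ▸ Multiset.mem_cons_self _ _
      rcases Multiset.mem_add.1 this with h | h
      · exact h
      · obtain ⟨_, _, h', -⟩ := hC _ h
        cases h'
    obtain ⟨l', hl'⟩ := Multiset.exists_cons_of_mem hmem
    obtain ⟨l', rfl⟩ : ∃ k : List (Formula W), (k : Multiset (Formula W)) = l' :=
        Quot.exists_rep l'
    rw [hl', Multiset.cons_add, Multiset.cons_inj_right] at hm
    subst hm
    have := ih (A :: B :: l') C (by
      rw [← Multiset.cons_coe, ← Multiset.cons_coe, Multiset.cons_add, Multiset.cons_add]) hC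
    exact (RealSeq.par (l := []) this).perm (Multiset.coe_eq_coe.1 hl'.symm)
  | @tens A B Γ Δ h h' ih ih' =>
    intro l C hm hC
    have hmem : A.tens B ∈ (l : Multiset (Formula W)) + C := hm ▸ Multiset.mem_cons_self _ _
    rcases Multiset.mem_add.1 hmem with hmem | hmem
    · obtain ⟨l', hl'⟩ := Multiset.exists_cons_of_mem hmem
      obtain ⟨l', rfl⟩ : ∃ k : List (Formula W), (k : Multiset (Formula W)) = l' :=
        Quot.exists_rep l'
      rw [hl', Multiset.cons_add, Multiset.cons_inj_right] at hm
      obtain ⟨l₁, l₂, C₁, C₂, rfl, rfl, hl, rfl⟩ := exists_add_of_add_eq hm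
      have h₁ := ih (l₁ ++ [A]) C₁ (by simp [← Multiset.coe_add, ← Multiset.singleton_add]; abel)
        fun X hX => hC X (Multiset.mem_add.2 (.inl hX))
      have h₂ := ih' (B :: l₂) C₂ (Multiset.cons_add _ _ _).symm
        fun X hX => hC X (Multiset.mem_add.2 (.inr hX))
      refine (h₁.tens h₂).perm (List.perm_middle.trans (Multiset.coe_eq_coe.1 ?_))
      rw [hl', ← Multiset.cons_coe, ← hl]
    · obtain ⟨C', rfl⟩ := Multiset.exists_cons_of_mem hmem
      rw [Multiset.add_cons, Multiset.cons_inj_right] at hm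
      obtain ⟨l₁, l₂, C₁, C₂, rfl, rfl, hl, rfl⟩ := exists_add_of_add_eq hm
      have h₁ := ih (l₁ ++ [A]) C₁ (by simp [← Multiset.coe_add, ← Multiset.singleton_add]; abel)
        fun X hX => hC X (by simp [hX])
      have h₂ := ih' (B :: l₂) C₂ (Multiset.cons_add _ _ _).symm
        fun X hX => hC X (by simp [hX])
      obtain ⟨_, _, he, hAB⟩ := hC (A.tens B) (Multiset.mem_cons_self _ _)
      obtain ⟨rfl, rfl⟩ := Formula.tens.inj he
      exact (RealSeq.cut hAB h₁ h₂).perm (Multiset.coe_eq_coe.1 hl.symm)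

end SeqProofs

/-! ### Decorated proofs in the calculus of structures -/

section CosProofs

variable {V : Type u} {W : Type v}

theorem Ctx.deco_fill' (S : Ctx V) (X : Formula V) (d : X.leaf.carrier ⊕ S.leaf.carrier → Atom W) :
    (S.fill X).deco (fun x => d ((fillFlow S X).equiv x)) =
      (S.deco fun x => d (.inr x)).fill (X.deco fun x => d (.inl x)) := by
  simp [Ctx.deco_fill]

theorem Ctx.map_deco_fill {π : W → V} (S : Ctx V) (X : Formula V)
    (d : (S.fill X).leaf.carrier → Atom W) (h : ∀ x, (d x).map π = (S.fill X).leaf.lab x) :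
    (S.deco fun x => d ((fillFlow S X).equiv.symm (.inr x))).map π = S :=
  S.map_deco π _ fun x => (h _).trans ((fillFlow S X).symm.lab_eq (.inr x))

/-- The tagged context is the same before and after the rule, and only the active subformula is
rearranged. -/
theorem deco_deepFlow {π : W → V} (S : Ctx V) {X Y : Formula V} (e : AtomFlow X.leaf Y.leaf)
    (d : (seqLeaf [S.fill Y]).carrier → Atom W)
    (hd : ∀ x, (d x).map π = (seqLeaf [S.fill Y]).lab x) :
    ∃ (S' : Ctx W) (f : Y.leaf.carrier → Atom W), S'.map π = S ∧
      (S.fill X).deco (fun x => d ((deepFlow S e).equiv (.inl x))) =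
        S'.fill (X.deco fun x => f (e.equiv x)) ∧
      (S.fill Y).deco (fun x => d (.inl x)) = S'.fill (Y.deco f) :=
  ⟨_, fun y => d (.inl ((fillFlow S Y).equiv.symm (.inl y))),
    S.map_deco_fill Y _ fun x => hd (.inl x),
    S.deco_fill' X fun z => d (.inl ((fillFlow S Y).equiv.symm
      ((e.sumCongr (AtomFlow.refl _)).equiv z))), S.deco_fill Y _⟩

theorem deco_idownFlow {π : W → V} (S : Ctx V) (A B : Formula V)
    (d : (seqLeaf [S.fill ((A.dual.par A).tens B)]).carrier → Atom W)
    (hd : ∀ x, (d x).map π = (seqLeaf [S.fill ((A.dual.par A).tens B)]).lab x) :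
    ∃ (S' : Ctx W) (b : Formula W), S'.map π = S ∧
      (S.fill B).deco (fun x => d ((idownFlow S A B).equiv (.inr (.inl x)))) = S'.fill b ∧
      (S.fill ((A.dual.par A).tens B)).deco (fun x => d (.inl x)) =
        S'.fill (((A.dual.deco fun x => d ((idownFlow S A B).equiv (.inl (.inl x)))).par
          (A.deco fun x => d ((idownFlow S A B).equiv (.inl (.inr x))))).tens b) :=
  ⟨_, _, S.map_deco_fill _ _ fun x => hd (.inl x),
    S.deco_fill' B fun z => d (.inl ((fillFlow S ((A.dual.par A).tens B)).equiv.symm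
      ((AtomFlow.sumAssoc (A.dual.leaf.sum A.leaf) B.leaf S.leaf).equiv.symm (.inr z)))),
    S.deco_fill _ _⟩

theorem deco_iupFlow {π : W → V} (S : Ctx V) (A B : Formula V)
    (f : (cutTree A).leaf.carrier → Atom W) (d : (seqLeaf [S.fill B]).carrier → Atom W)
    (hd : ∀ x, (d x).map π = (seqLeaf [S.fill B]).lab x) :
    ∃ (S' : Ctx W) (b : Formula W), S'.map π = S ∧ b.map π = B ∧
      (S.fill (B.par (A.tens A.dual))).deco
        (fun x => Sum.elim f d ((iupFlow S A B).equiv (.inl x))) =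
          S'.fill (b.par ((cutTree A).deco f)) ∧
      (S.fill B).deco (fun x => d (.inl x)) = S'.fill b := by
  refine ⟨_, _, S.map_deco_fill _ _ fun x => hd (.inl x), ?_, ?_, S.deco_fill _ _⟩
  · exact Formula.map_deco π _ _ fun x => (hd _).trans ((fillFlow S B).symm.lab_eq (.inl x))
  · let g : AtomFlow ((B.leaf.sum (A.leaf.sum A.dual.leaf)).sum S.leaf)
        ((A.leaf.sum A.dual.leaf).sum (S.fill B).leaf) :=
      ((AtomFlow.sumComm B.leaf (A.leaf.sum A.dual.leaf)).sumCongr (AtomFlow.refl S.leaf)).trans <|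
      (AtomFlow.sumAssoc _ B.leaf S.leaf).trans <|
      (AtomFlow.refl _).sumCongr (fillFlow S B).symm
    exact S.deco_fill' (B.par (A.tens A.dual)) fun z => Sum.elim f d
      ((AtomFlow.sumAssoc _ (S.fill B).leaf (OccSet.empty V)).equiv (.inl (g.equiv z)))

/-- The number of leaves minus twice the number of tensors. -/
def Formula.val : Formula V → ℤ
  | .atom _ => 1
  | .par A B => A.val + B.val
  | .tens A B => A.val + B.val - 2

theorem Formula.val_dual (A : Formula V) : A.dual.val = 2 - A.val := by
  induction A with
  | atom x => rfl
  | par A B hA hB => simp only [Formula.dual, Formula.val, hA, hB]; ring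
  | tens A B hA hB => simp only [Formula.dual, Formula.val, hA, hB]; ring

theorem Ctx.val_fill (S : Ctx V) {X Y : Formula V} (h : X.val = Y.val) :
    (S.fill X).val = (S.fill Y).val := by
  induction S <;> simp_all [Ctx.fill, Formula.val]

/-- A^⊥ ⅋ A has value 2, and every rule between two formulas preserves the value. Since A ⊗ A^⊥ has
value 0, it is never proved, so the instance of i↑ that leads to nothing never occurs in a proof. -/
theorem CosProof.val_eq {X : Option (Formula V)} (q : CosProof X) : ∀ F ∈ X, F.val = 2 := by
  induction q with
  | nil => simp
  | snoc p r ih =>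
    cases r <;> simp only [Option.mem_def, Option.some.injEq, forall_eq', reduceCtorEq,
      false_imp_iff, implies_true] at ih ⊢
    case idown0 A => simp only [Formula.val, Formula.val_dual]; ring
    all_goals
      rw [← ih]
      apply Ctx.val_fill
      simp only [Formula.val, Formula.val_dual]
      ring

/-- The decorated conclusions and cuts of a net are provable. -/
def PreNet.CosProv (π : W → V) : (X : Option (Formula V)) → PreNet X.toList → Prop
  -- Without a conclusion only the empty derivation is possible. Its net has no cuts, as the case of
  -- the initial i↓ requires.
  | none, N => IsEmpty N.Cut
  | some F, N => ∀ (d : (seqLeaf [F]).carrier → Atom W)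
      (c : (i : N.Cut) → (cutTree (N.cut i)).leaf.carrier → Atom W), N.Decor π d c →
      Prov (F.deco (fun x => d (.inl x)) ::ₘ N.cutDeco c)

theorem PreNet.cosProv_flow {π : W → V} (S : Ctx V) {X Y : Formula V} (e : AtomFlow X.leaf Y.leaf)
    (he : ∀ f : Y.leaf.carrier → Atom W, Shuffle (X.deco fun x => f (e.equiv x)) (Y.deco f))
    {N : PreNet [S.fill X]} (h : CosProv π (some (S.fill X)) N) :
    CosProv π (some (S.fill Y)) (N.flow (deepFlow S e)) := by
  intro d c hd
  obtain ⟨S', f, -, h₁, h₂⟩ := deco_deepFlow S e d fun x => hd.1 (.inl x)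
  have := h _ _ ((PreNet.decor_flow _ _ _ _).1 hd)
  refine Prov.cast ?_ (congrArg (· ::ₘ _) h₂.symm)
  exact Prov.shuffle_deep (he f) S' _ (this.cast (congrArg (· ::ₘ _) h₁))

theorem CosProof.prov (π : W → V) {X : Option (Formula V)} (q : CosProof X) :
    PreNet.CosProv π X q.net := by
  induction q with
  | nil => exact inferInstanceAs (IsEmpty Empty)
  | snoc p r ih =>
    cases r with
    | idown0 A =>
      intro d c hd
      have h := ((PreNet.decor_addId _ _ _ _ _).1 hd).1.2
      have : IsEmpty p.net.Cut := ih
      have hc : (CosProof.snoc p (.idown0 A)).net.cutDeco c = 0 :=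
        famDeco_empty (ι := p.net.Cut) _
      rw [hc]
      refine (Prov.identity _).par.cast (congrArg (· ::ₘ 0)
        (congrArg (Formula.par · (A.deco fun x => d (.inl (.inr x)))) h.symm))
    | iup0 A =>
      have := p.val_eq _ rfl
      simp [Formula.val, Formula.val_dual] at this
    | idown S A B =>
      intro d c hd
      obtain ⟨⟨-, h⟩, hN⟩ := (PreNet.decor_addId _ _ _ _ _).1 hd
      obtain ⟨S', b, -, h₁, h₂⟩ := deco_idownFlow S A B d fun x => hd.1 (.inl x)
      replace h₂ := h₂.trans (congrArg (fun t => S'.fill ((Formula.par t _).tens b)) h)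
      refine Prov.cast ?_ (congrArg (· ::ₘ _) h₂.symm)
      exact Prov.idown S' _ b _ ((ih _ _ hN).cast (congrArg (· ::ₘ _) h₁))
    | iup S A B =>
      intro d c hd
      obtain ⟨S', b, -, -, h₁, h₂⟩ := deco_iupFlow S A B (c (.inr ())) d fun x => hd.1 (.inl x)
      have := ih _ _ ((PreNet.decor_addCut _ _ _ _ _).1 hd)
      refine Prov.cast ?_ (congrArg₂ Multiset.cons h₂.symm (PreNet.cutDeco_addCut _ _ _ _).symm)
      exact Prov.iup S' b _ _ (this.cast (congrArg (· ::ₘ _) h₁))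
    | comDown S A B =>
      exact PreNet.cosProv_flow S (X := A.par B) (Y := B.par A)
        (AtomFlow.sumComm A.leaf B.leaf) (fun f => .comDown _ _) ih
    | comUp S A B =>
      exact PreNet.cosProv_flow S (X := A.tens B) (Y := B.tens A)
        (AtomFlow.sumComm A.leaf B.leaf) (fun f => .comUp _ _) ih
    | assDown S A B C =>
      exact PreNet.cosProv_flow S (X := A.par (B.par C)) (Y := (A.par B).par C)
        ((AtomFlow.sumAssoc A.leaf B.leaf C.leaf).symm) (fun f => .assDown _ _ _) ih
    | assUp S A B C =>
      exact PreNet.cosProv_flow S (X := A.tens (B.tens C)) (Y := (A.tens B).tens C)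
        ((AtomFlow.sumAssoc A.leaf B.leaf C.leaf).symm) (fun f => .assUp _ _ _) ih
    | switch S A B C =>
      exact PreNet.cosProv_flow S (X := A.tens (B.par C)) (Y := (A.tens B).par C)
        ((AtomFlow.sumAssoc A.leaf B.leaf C.leaf).symm) (fun f => .switch _ _ _) ih

/-- There is a proof in the calculus of structures whose net has the given decorated conclusion and
cuts. -/
def RealCos (π : W → V) (F' : Formula W) (C : Multiset (Formula W)) : Prop :=
  ∃ (F : Formula V) (q : CosProof (some F)) (d : (seqLeaf [F]).carrier → Atom W)
    (c : (i : q.net.Cut) → (cutTree (q.net.cut i)).leaf.carrier → Atom W),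
    q.net.Decor π d c ∧ F.deco (fun x => d (.inl x)) = F' ∧ q.net.cutDeco c = C

namespace RealCos

variable {π : W → V}

theorem exists_of_eq {F' : Formula W} {C : Multiset (Formula W)} (h : RealCos π F' C)
    {F : Formula V} (hF : F'.map π = F) :
    ∃ (q : CosProof (some F)) (d : (seqLeaf [F]).carrier → Atom W)
    (c : (i : q.net.Cut) → (cutTree (q.net.cut i)).leaf.carrier → Atom W),
    q.net.Decor π d c ∧ F.deco (fun x => d (.inl x)) = F' ∧ q.net.cutDeco c = C := by
  obtain ⟨G, q, d, c, hd, rfl, hC⟩ := h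
  obtain rfl := (G.map_deco π _ fun x => hd.1 (.inl (.inl x))).symm.trans hF
  exact ⟨q, d, c, hd, rfl, hC⟩

theorem id (A : Formula W) : RealCos π (A.dual.par A) 0 := by
  obtain ⟨f, hf, hf'⟩ := A.exists_deco π
  obtain ⟨g, hg, hg'⟩ : ∃ g : (A.map π).dual.leaf.carrier → Atom W,
      (A.map π).dual.deco g = A.dual ∧ ∀ x, (g x).map π = (A.map π).dual.leaf.lab x := by
    rw [← Formula.map_dual]
    exact A.dual.exists_deco π
  refine ⟨_, .snoc .nil (.idown0 (A.map π)), _, _, PreNet.Decor.addId (W := W) _ _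
    (PreNet.decor_nil (fun x => x.elim) (fun i => i.elim)) (f := f)
    (f' := g) hf' (by rw [hf, hg]), ?_, PreNet.cutDeco_nil _⟩
  exact congrArg₂ Formula.par hg hf

theorem deep {S : Ctx W} {X' Y' : Formula W} {C : Multiset (Formula W)} {X Y : Formula V}
    (h : RealCos π (S.fill X') C) (hX : X'.map π = X) (e : AtomFlow X.leaf Y.leaf)
    (he : ∀ f : Y.leaf.carrier → Atom W, X.deco (fun x => f (e.equiv x)) = X' → Y.deco f = Y')
    (r : Step (some ((S.map π).fill X)) (some ((S.map π).fill Y)))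
    (hr : ∀ N : PreNet [(S.map π).fill X], r.apply N = N.flow (deepFlow (S.map π) e)) :
    RealCos π (S.fill Y') C := by
  obtain ⟨q, d, c, hd, hF, hC⟩ := h.exists_of_eq (F := (S.map π).fill X) (by rw [Ctx.map_fill, hX])
  -- The tagging of the cuts has a type that depends on the net, so the net is generalised before
  -- the equation for it is substituted.
  suffices H : ∀ N : PreNet [(S.map π).fill Y], N = q.net.flow (deepFlow (S.map π) e) →
      ∃ (d : (seqLeaf [(S.map π).fill Y]).carrier → Atom W)
        (c : (i : N.Cut) → (cutTree (N.cut i)).leaf.carrier → Atom W),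
        N.Decor π d c ∧ ((S.map π).fill Y).deco (fun x => d (.inl x)) = S.fill Y' ∧
          N.cutDeco c = C by
    obtain ⟨d, c, h⟩ := H _ (hr q.net)
    exact ⟨_, q.snoc r, d, c, h⟩
  rintro _ rfl
  have hd' := hd.flow (deepFlow (S.map π) e)
  refine ⟨_, c, hd', ?_, hC⟩
  obtain ⟨S', f, hS, h₁, h₂⟩ := deco_deepFlow (π := π) (S.map π) e
    (fun y => d ((deepFlow (S.map π) e).equiv.symm y)) fun x => hd'.1 (.inl x)
  replace h₁ := (congrArg (Formula.deco _) (funext fun x => congrArg d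
    ((deepFlow (S.map π) e).equiv.symm_apply_apply (.inl x)))).symm.trans h₁
  obtain ⟨rfl, h₃⟩ := Ctx.fill_inj_of_map_eq π hS (h₁.symm.trans hF)
  rw [he f h₃] at h₂
  exact h₂

theorem shuffle {S : Ctx W} {X Y : Formula W} {C : Multiset (Formula W)} (s : Shuffle X Y)
    (h : RealCos π (S.fill X) C) : RealCos π (S.fill Y) C := by
  cases s with
  | comDown A B =>
    refine h.deep rfl _ (fun f hf => ?_) (.comDown (S.map π) _ _) fun _ => rfl
    obtain ⟨h₁, h₂⟩ := Formula.par.inj hf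
    exact congrArg₂ _ h₂ h₁
  | comUp A B =>
    refine h.deep rfl _ (fun f hf => ?_) (.comUp (S.map π) _ _) fun _ => rfl
    obtain ⟨h₁, h₂⟩ := Formula.tens.inj hf
    exact congrArg₂ _ h₂ h₁
  | assDown A B C =>
    refine h.deep rfl _ (fun f hf => ?_) (.assDown (S.map π) _ _ _) fun _ => rfl
    obtain ⟨h₁, h₂⟩ := Formula.par.inj hf
    obtain ⟨h₂, h₃⟩ := Formula.par.inj h₂
    exact congrArg₂ _ (congrArg₂ _ h₁ h₂) h₃
  | assUp A B C =>
    refine h.deep rfl _ (fun f hf => ?_) (.assUp (S.map π) _ _ _) fun _ => rfl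
    obtain ⟨h₁, h₂⟩ := Formula.tens.inj hf
    obtain ⟨h₂, h₃⟩ := Formula.tens.inj h₂
    exact congrArg₂ _ (congrArg₂ _ h₁ h₂) h₃
  | switch A B C =>
    refine h.deep rfl _ (fun f hf => ?_) (.switch (S.map π) _ _ _) fun _ => rfl
    obtain ⟨h₁, h₂⟩ := Formula.tens.inj hf
    obtain ⟨h₂, h₃⟩ := Formula.par.inj h₂
    exact congrArg₂ _ (congrArg₂ _ h₁ h₂) h₃

theorem idown {S : Ctx W} {B : Formula W} {C : Multiset (Formula W)} (A : Formula W)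
    (h : RealCos π (S.fill B) C) : RealCos π (S.fill ((A.dual.par A).tens B)) C := by
  obtain ⟨f, hf, hf'⟩ := A.exists_deco π
  obtain ⟨g, hg, hg'⟩ : ∃ g : (A.map π).dual.leaf.carrier → Atom W,
      (A.map π).dual.deco g = A.dual ∧ ∀ x, (g x).map π = (A.map π).dual.leaf.lab x := by
    rw [← Formula.map_dual]
    exact A.dual.exists_deco π
  obtain ⟨q, d, c, hd, hF, hC⟩ := h.exists_of_eq (Ctx.map_fill π S B)
  have hd' := hd.addId (A.map π) (idownFlow (S.map π) (A.map π) (B.map π)) hf'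
    (f' := g) (by rw [hf, hg])
  refine ⟨_, q.snoc (.idown (S.map π) (A.map π) (B.map π)), _, c, hd', ?_, hC⟩
  obtain ⟨S', b, hS, h₁, h₂⟩ := deco_idownFlow (π := π) (S.map π) (A.map π) (B.map π)
    (fun y => Sum.elim (Sum.elim g f) d ((idownFlow (S.map π) (A.map π) (B.map π)).equiv.symm y))
    fun x => hd'.1 (.inl x)
  simp only [Equiv.symm_apply_apply] at h₁
  obtain ⟨rfl, rfl⟩ := Ctx.fill_inj_of_map_eq π hS (h₁.symm.trans hF)
  refine h₂.trans ?_
  simp only [Equiv.symm_apply_apply, Sum.elim_inl, Sum.elim_inr]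
  rw [hf, hg]

theorem iup {S : Ctx W} {B X : Formula W} {C : Multiset (Formula W)} (hX : IsCut π X)
    (h : RealCos π (S.fill (B.par X)) C) : RealCos π (S.fill B) (X ::ₘ C) := by
  obtain ⟨A, A', rfl, hA⟩ := hX
  obtain ⟨q, d, c, hd, hF, hC⟩ := h.exists_of_eq
    (F := (S.map π).fill ((B.map π).par ((A.map π).tens (A.map π).dual))) (by
      rw [Ctx.map_fill, ← hA]
      rfl)
  have hd' := hd.addCut (A.map π) (iupFlow (S.map π) (A.map π) (B.map π))
  refine ⟨_, q.snoc (.iup (S.map π) (A.map π) (B.map π)), _, _, hd', ?_⟩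
  obtain ⟨S', b, hS, hb, h₁, h₂⟩ := deco_iupFlow (π := π) (S.map π) (A.map π) (B.map π)
    (fun y => d ((iupFlow (S.map π) (A.map π) (B.map π)).equiv.symm (.inl y))) _
    fun x => hd'.1 (.inl x)
  have hs (z) : Sum.elim
      (fun y => d ((iupFlow (S.map π) (A.map π) (B.map π)).equiv.symm (.inl y)))
      (fun y => d ((iupFlow (S.map π) (A.map π) (B.map π)).equiv.symm (.inr y)))
      ((iupFlow (S.map π) (A.map π) (B.map π)).equiv z) = d z := by
    conv_rhs => rw [← (iupFlow (S.map π) (A.map π) (B.map π)).equiv.symm_apply_apply z]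
    rcases (iupFlow (S.map π) (A.map π) (B.map π)).equiv z with x | x <;> rfl
  have h₃ := (congrArg (Formula.deco _) (funext fun x => hs (.inl x))).symm.trans h₁
  obtain ⟨rfl, h₄⟩ := Ctx.fill_inj_of_map_eq π hS (h₃.symm.trans hF)
  obtain ⟨rfl, h₅⟩ := Formula.par.inj h₄
  exact ⟨h₂, (PreNet.cutDeco_addCut _ _ _ _).trans (congrArg₂ _ h₅ hC)⟩

end RealCos

theorem DCos.realCos {π : W → V} {F : Formula W} {C : Multiset (Formula W)} (h : DCos π F C) :
    RealCos π F C := by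
  induction h with
  | id A => exact .id A
  | idown S A B _ ih => exact ih.idown A
  | iup S B C hC _ ih => exact ih.iup hC
  | shuffle S s _ ih => exact ih.shuffle s

end CosProofs

/-! ### Correctness -/

section Correctness

variable {V : Type u} {W : Type v} {Q : Type}

/-- All atoms of a formula have the property `P`. -/
def Formula.All (P : Atom W → Prop) : Formula W → Prop
  | .atom x => P x
  | .par A B => A.All P ∧ B.All P
  | .tens A B => A.All P ∧ B.All P

theorem Formula.all_deco (P : Atom W → Prop) (A : Formula V) (d : A.leaf.carrier → Atom W) :
    (A.deco d).All P ↔ ∀ x, P (d x) := by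
  induction A with
  | atom x => exact ⟨fun h _ => h, fun h => h ()⟩
  | par A B hA hB =>
    refine (and_congr (hA _) (hB _)).trans ⟨?_, fun h => ⟨fun x => h (.inl x), fun x => h (.inr x)⟩⟩
    rintro ⟨h, h'⟩ (x | x)
    exacts [h x, h' x]
  | tens A B hA hB =>
    refine (and_congr (hA _) (hB _)).trans ⟨?_, fun h => ⟨fun x => h (.inl x), fun x => h (.inr x)⟩⟩
    rintro ⟨h, h'⟩ (x | x)
    exacts [h x, h' x]

/-- `A.Root f c`: for some switching of `A`, the root of `A` may belong to the component `c`, if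
each atom `x` belongs to the component `f x`. -/
def Formula.Root (f : Atom W → Q) : Formula W → Q → Prop
  | .atom x, c => c = f x
  | .par A B, c => (A.Root f c ∧ ∃ c', B.Root f c') ∨ ((∃ c', A.Root f c') ∧ B.Root f c)
  | .tens A B, c => A.Root f c ∧ B.Root f c

theorem Formula.Root.eq_of_all {f : Atom W → Q} {q : Q} : ∀ {A : Formula W} {c : Q},
    A.Root f c → A.All (fun x => f x = q) → c = q
  | .atom _, _, h, h' => h.trans h'
  | .par _ _, _, .inl h, h' => eq_of_all h.1 h'.1
  | .par _ _, _, .inr h, h' => eq_of_all h.2 h'.2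
  | .tens _ _, _, h, h' => eq_of_all h.1 h'.1

/-- By induction, each premise carries a single component. At a ⊗-rule the two factors share a root
component, which forces the components of the two premises to coincide. At a ⅋-rule, `Root` gives
both children a possible root component, as the premise requires. -/
theorem Prov.exists_all_eq {m : Multiset (Formula W)} (h : Prov m) (f : Atom W → Q)
    (hf : ∀ x, f x.dual = f x) (hm : ∀ A ∈ m, ∃ c, A.Root f c) :
    ∃ q, ∀ A ∈ m, A.All (fun x => f x = q) := by
  induction h with
  | id x =>
    refine ⟨f x, fun A hA => ?_⟩
    rcases Multiset.mem_cons.1 hA with rfl | hA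
    · exact hf x
    · obtain rfl := Multiset.mem_singleton.1 hA
      exact rfl
  | @par A B Γ _ ih =>
    simp only [Multiset.mem_cons, forall_eq_or_imp] at ih hm ⊢
    obtain ⟨⟨c, hc⟩, hΓ⟩ := hm
    obtain ⟨q, hA, hB, hq⟩ := ih ⟨by rcases hc with h | h; exacts [⟨_, h.1⟩, h.1],
      by rcases hc with h | h; exacts [h.2, ⟨_, h.2⟩], hΓ⟩
    exact ⟨q, ⟨hA, hB⟩, hq⟩
  | @tens A B Γ Δ _ _ ih ih' =>
    simp only [Multiset.mem_cons, forall_eq_or_imp, Multiset.mem_add] at ih ih' hm ⊢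
    obtain ⟨⟨c, hc, hc'⟩, hΓ⟩ := hm
    obtain ⟨q, hA, hq⟩ := ih ⟨⟨c, hc⟩, fun X hX => hΓ X (.inl hX)⟩
    obtain ⟨q', hB, hq'⟩ := ih' ⟨⟨c, hc'⟩, fun X hX => hΓ X (.inr hX)⟩
    obtain rfl := hc.eq_of_all hA
    obtain rfl := hc'.eq_of_all hB
    exact ⟨c, ⟨hA, hB⟩, fun X hX => hX.elim (hq X) (hq' X)⟩

theorem Formula.root_deco {f : Atom W → Q} : ∀ (A : Formula V) (s : A.Switching) (g : A.Node → Q)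
    (d : A.leaf.carrier → Atom W), (∀ x y, A.Edge s x y → g x = g y) →
    (∀ x, f (d x) = g (A.leafNode x)) → (A.deco d).Root f (g A.root)
  | .atom _, _, _, _, _, h => (h ()).symm
  | .par A B, (b, s, t), g, d, hg, h => by
    have hA := root_deco A s (fun x => g (some (.inl x))) (fun x => d (.inl x))
      (fun x y => hg (some (.inl x)) (some (.inl y))) fun x => h (.inl x)
    have hB := root_deco B t (fun x => g (some (.inr x))) (fun x => d (.inr x))
      (fun x y => hg (some (.inr x)) (some (.inr y))) fun x => h (.inr x)
    cases b with
    | true =>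
      have := hg none (some (.inl A.root)) ⟨rfl, rfl⟩
      exact .inl ⟨this ▸ hA, _, hB⟩
    | false =>
      have := hg none (some (.inr B.root)) ⟨rfl, rfl⟩
      exact .inr ⟨⟨_, hA⟩, this ▸ hB⟩
  | .tens A B, (s, t), g, d, hg, h => by
    have hA := root_deco A s (fun x => g (some (.inl x))) (fun x => d (.inl x))
      (fun x y => hg (some (.inl x)) (some (.inl y))) fun x => h (.inl x)
    have hB := root_deco B t (fun x => g (some (.inr x))) (fun x => d (.inr x))
      (fun x y => hg (some (.inr x)) (some (.inr y))) fun x => h (.inr x)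
    have h₁ := hg none (some (.inl A.root)) rfl
    have h₂ := hg none (some (.inr B.root)) rfl
    exact ⟨h₁ ▸ hA, h₂ ▸ hB⟩

/-- After switching, every node is connected to a leaf below it. -/
theorem Formula.exists_leaf : ∀ (A : Formula V) (s : A.Switching) (g : A.Node → Q),
    (∀ x y, A.Edge s x y → g x = g y) → ∀ y, ∃ x, g (A.leafNode x) = g y
  | .atom _, _, _, _, _ => ⟨(), rfl⟩
  | .par A B, (b, s, t), g, hg, y => by
    have hA := exists_leaf A s (fun x => g (some (.inl x)))
      (fun x y => hg (some (.inl x)) (some (.inl y)))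
    have hB := exists_leaf B t (fun x => g (some (.inr x)))
      (fun x y => hg (some (.inr x)) (some (.inr y)))
    rcases y with _ | y | y
    · cases b with
      | true =>
        obtain ⟨x, hx⟩ := hA A.root
        exact ⟨.inl x, hx.trans (hg none (some (.inl A.root)) ⟨rfl, rfl⟩).symm⟩
      | false =>
        obtain ⟨x, hx⟩ := hB B.root
        exact ⟨.inr x, hx.trans (hg none (some (.inr B.root)) ⟨rfl, rfl⟩).symm⟩
    · obtain ⟨x, hx⟩ := hA y
      exact ⟨.inl x, hx⟩
    · obtain ⟨x, hx⟩ := hB y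
      exact ⟨.inr x, hx⟩
  | .tens A B, (s, t), g, hg, y => by
    have hA := exists_leaf A s (fun x => g (some (.inl x)))
      (fun x y => hg (some (.inl x)) (some (.inl y)))
    have hB := exists_leaf B t (fun x => g (some (.inr x)))
      (fun x y => hg (some (.inr x)) (some (.inr y)))
    rcases y with _ | y | y
    · obtain ⟨x, hx⟩ := hA A.root
      exact ⟨.inl x, hx.trans (hg none (some (.inl A.root)) rfl).symm⟩
    · obtain ⟨x, hx⟩ := hA y
      exact ⟨.inl x, hx⟩
    · obtain ⟨x, hx⟩ := hB y
      exact ⟨.inr x, hx⟩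

theorem root_seqDeco {f : Atom W → Q} : ∀ (Γ : List (Formula V)) (s : SeqSwitching Γ)
    (g : SeqNode Γ → Q) (d : (seqLeaf Γ).carrier → Atom W),
    (∀ x y, SeqEdge Γ s x y → g x = g y) → (∀ x, f (d x) = g (seqLeafNode Γ x)) →
    ∀ A ∈ seqDeco Γ d, ∃ c, A.Root f c
  | [], _, _, _, _, _, _, hA => nomatch hA
  | A :: Γ, s, g, d, hg, h, X, hX => by
    rcases List.mem_cons.1 hX with rfl | hX
    · exact ⟨_, A.root_deco s.1 (fun x => g (.inl x)) _ (fun x y => hg (.inl x) (.inl y))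
        fun x => h (.inl x)⟩
    · exact root_seqDeco Γ s.2 (fun x => g (.inr x)) _ (fun x y => hg (.inr x) (.inr y))
        (fun x => h (.inr x)) X hX

theorem exists_seqLeaf : ∀ (Γ : List (Formula V)) (s : SeqSwitching Γ) (g : SeqNode Γ → Q),
    (∀ x y, SeqEdge Γ s x y → g x = g y) → ∀ y, ∃ x, g (seqLeafNode Γ x) = g y
  | [], _, _, _, y => y.elim
  | A :: Γ, s, g, hg, y => by
    rcases y with y | y
    · obtain ⟨x, hx⟩ := A.exists_leaf s.1 (fun x => g (.inl x)) (fun x y => hg (.inl x) (.inl y)) y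
      exact ⟨.inl x, hx⟩
    · obtain ⟨x, hx⟩ := exists_seqLeaf Γ s.2 (fun x => g (.inr x))
        (fun x y => hg (.inr x) (.inr y)) y
      exact ⟨.inr x, hx⟩

theorem all_seqDeco {P : Atom W → Prop} : ∀ (Γ : List (Formula V))
    (d : (seqLeaf Γ).carrier → Atom W), (∀ A ∈ seqDeco Γ d, A.All P) → ∀ x, P (d x)
  | [], _, _, x => x.elim
  | A :: _, _, h, .inl x => (A.all_deco P _).1 (h _ (List.mem_cons_self ..)) x
  | _ :: Γ, _, h, .inr x => all_seqDeco Γ _ (fun X hX => h X (List.mem_cons_of_mem _ hX)) x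

/-! #### Counting nodes and edges -/

instance Formula.finite_leaf : ∀ A : Formula V, Finite A.leaf.carrier
  | .atom _ => inferInstanceAs (Finite Unit)
  | .par A B => haveI := finite_leaf A; haveI := finite_leaf B
    inferInstanceAs (Finite (A.leaf.carrier ⊕ B.leaf.carrier))
  | .tens A B => haveI := finite_leaf A; haveI := finite_leaf B
    inferInstanceAs (Finite (A.leaf.carrier ⊕ B.leaf.carrier))

instance Formula.finite_node : ∀ A : Formula V, Finite A.Node
  | .atom _ => inferInstanceAs (Finite Unit)
  | .par A B => haveI := finite_node A; haveI := finite_node B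
    inferInstanceAs (Finite (Option (A.Node ⊕ B.Node)))
  | .tens A B => haveI := finite_node A; haveI := finite_node B
    inferInstanceAs (Finite (Option (A.Node ⊕ B.Node)))

instance finite_seqLeaf : ∀ Γ : List (Formula V), Finite (seqLeaf Γ).carrier
  | [] => inferInstanceAs (Finite Empty)
  | A :: Γ => haveI := finite_seqLeaf Γ
    inferInstanceAs (Finite (A.leaf.carrier ⊕ (seqLeaf Γ).carrier))

instance finite_seqNode : ∀ Γ : List (Formula V), Finite (SeqNode Γ)
  | [] => inferInstanceAs (Finite Empty)
  | A :: Γ => haveI := finite_seqNode Γ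
    inferInstanceAs (Finite (A.Node ⊕ SeqNode Γ))

/-- The edges of a formula tree that are kept by a switching. -/
def Formula.edges (A : Formula V) (s : A.Switching) : Set (A.Node × A.Node) :=
  {p | A.Edge s p.1 p.2}

theorem Formula.card_node_binary (A B : Formula V) :
    Nat.card (Option (A.Node ⊕ B.Node)) = Nat.card A.Node + Nat.card B.Node + 1 := by
  rw [Finite.card_option, Nat.card_sum]

/-- A tree with L leaves, t tensors and p ⅋s has L + t + p nodes, keeps 2t + p edges, and has value
L − 2t. Since L = t + p + 1, the two sides are in fact equal; bounding the edges by a covering set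
yields the inequality that is needed. -/
theorem Formula.two_mul_ncard_edges_le : ∀ (A : Formula V) (s : A.Switching),
    2 * ((A.edges s).ncard : ℤ) + Nat.card A.leaf.carrier + A.val ≤ 2 * Nat.card A.Node
  | .atom x, s => by
    have h : (Formula.atom x).edges s = ∅ := Set.eq_empty_of_forall_notMem fun _ h => h
    have h₁ : Nat.card (Formula.atom x).leaf.carrier = 1 := Nat.card_unique (α := Unit)
    have h₂ : Nat.card (Formula.atom x).Node = 1 := Nat.card_unique (α := Unit)
    rw [h, h₁, h₂]
    simp [Formula.val]
  | .par A B, (b, s, t) => by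
    have hA := two_mul_ncard_edges_le A s
    have hB := two_mul_ncard_edges_le B t
    have h₁ : Nat.card (A.par B).leaf.carrier = _ :=
      Nat.card_sum (α := A.leaf.carrier) (β := B.leaf.carrier)
    have h₂ : Nat.card (A.par B).Node = _ := A.card_node_binary B
    have h : (A.par B).edges (b, s, t) ⊆ insert (none, some (if b then .inl A.root else .inr B.root))
        ((fun p => (some (.inl p.1), some (.inl p.2))) '' A.edges s ∪
          (fun p => (some (.inr p.1), some (.inr p.2))) '' B.edges t) := by
      rintro ⟨_ | x | x, _ | y | y⟩ h
      case none.some.inl => obtain ⟨rfl, rfl⟩ := h; exact .inl rfl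
      case none.some.inr => obtain ⟨rfl, rfl⟩ := h; exact .inl rfl
      case some.inl.some.inl => exact .inr (.inl ⟨(x, y), h, rfl⟩)
      case some.inr.some.inr => exact .inr (.inr ⟨(x, y), h, rfl⟩)
      all_goals exact h.elim
    have h₃ := (Set.ncard_le_ncard h (Set.toFinite _)).trans ((Set.ncard_insert_le _ _).trans
      (Nat.add_le_add_right ((Set.ncard_union_le _ _).trans
        (Nat.add_le_add (Set.ncard_image_le (Set.toFinite _))
          (Set.ncard_image_le (Set.toFinite _)))) 1))
    rw [h₁, h₂]
    simp only [Formula.val]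
    push_cast
    have h₄ : (((A.par B).edges (b, s, t)).ncard : ℤ) ≤ (A.edges s).ncard + (B.edges t).ncard + 1 := by
      exact_mod_cast h₃
    linarith
  | .tens A B, (s, t) => by
    have hA := two_mul_ncard_edges_le A s
    have hB := two_mul_ncard_edges_le B t
    have h₁ : Nat.card (A.tens B).leaf.carrier = _ :=
      Nat.card_sum (α := A.leaf.carrier) (β := B.leaf.carrier)
    have h₂ : Nat.card (A.tens B).Node = _ := A.card_node_binary B
    have h : (A.tens B).edges (s, t) ⊆ insert (none, some (.inl A.root))
        (insert (none, some (.inr B.root))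
        ((fun p => (some (.inl p.1), some (.inl p.2))) '' A.edges s ∪
          (fun p => (some (.inr p.1), some (.inr p.2))) '' B.edges t)) := by
      rintro ⟨_ | x | x, _ | y | y⟩ h
      case none.some.inl => obtain rfl := h; exact .inl rfl
      case none.some.inr => obtain rfl := h; exact .inr (.inl rfl)
      case some.inl.some.inl => exact .inr (.inr (.inl ⟨(x, y), h, rfl⟩))
      case some.inr.some.inr => exact .inr (.inr (.inr ⟨(x, y), h, rfl⟩))
      all_goals exact h.elim
    have h₃ := (Set.ncard_le_ncard h (Set.toFinite _)).trans ((Set.ncard_insert_le _ _).trans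
      (Nat.add_le_add_right ((Set.ncard_insert_le _ _).trans
      (Nat.add_le_add_right ((Set.ncard_union_le _ _).trans
        (Nat.add_le_add (Set.ncard_image_le (Set.toFinite _))
          (Set.ncard_image_le (Set.toFinite _)))) 1)) 1))
    rw [h₁, h₂]
    simp only [Formula.val]
    push_cast
    have h₄ : (((A.tens B).edges (s, t)).ncard : ℤ) ≤
        (A.edges s).ncard + (B.edges t).ncard + 1 + 1 := by
      exact_mod_cast h₃
    linarith

/-- The edges of a sequent forest that are kept by a switching. -/
def seqEdges (Γ : List (Formula V)) (s : SeqSwitching Γ) : Set (SeqNode Γ × SeqNode Γ) :=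
  {p | SeqEdge Γ s p.1 p.2}

theorem two_mul_ncard_seqEdges_le : ∀ (Γ : List (Formula V)) (s : SeqSwitching Γ),
    2 * ((seqEdges Γ s).ncard : ℤ) + Nat.card (seqLeaf Γ).carrier + (Γ.map Formula.val).sum ≤
      2 * Nat.card (SeqNode Γ)
  | [], s => by
    have h : seqEdges ([] : List (Formula V)) s = ∅ := Set.eq_empty_of_forall_notMem fun _ h => h
    have h₁ : Nat.card (seqLeaf ([] : List (Formula V))).carrier = 0 :=
      Nat.card_of_isEmpty (α := Empty)
    rw [h, h₁]
    simp
  | A :: Γ, s => by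
    have hA := A.two_mul_ncard_edges_le s.1
    have hΓ := two_mul_ncard_seqEdges_le Γ s.2
    have h₁ : Nat.card (seqLeaf (A :: Γ)).carrier = _ :=
      Nat.card_sum (α := A.leaf.carrier) (β := (seqLeaf Γ).carrier)
    have h₂ : Nat.card (SeqNode (A :: Γ)) = _ := Nat.card_sum (α := A.Node) (β := SeqNode Γ)
    have h : seqEdges (A :: Γ) s ⊆
        (fun p => (.inl p.1, .inl p.2)) '' A.edges s.1 ∪
          (fun p => (.inr p.1, .inr p.2)) '' seqEdges Γ s.2 := by
      rintro ⟨x | x, y | y⟩ h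
      case inl.inl => exact .inl ⟨(x, y), h, rfl⟩
      case inr.inr => exact .inr ⟨(x, y), h, rfl⟩
      all_goals exact h.elim
    have h₃ := (Set.ncard_le_ncard h (Set.toFinite _)).trans ((Set.ncard_union_le _ _).trans
        (Nat.add_le_add (Set.ncard_image_le (Set.toFinite _))
          (Set.ncard_image_le (Set.toFinite _))))
    rw [h₁, h₂, List.map_cons, List.sum_cons]
    push_cast
    have h₄ : ((seqEdges (A :: Γ) s).ncard : ℤ) ≤ (A.edges s.1).ncard + (seqEdges Γ s.2).ncard := by
      exact_mod_cast h₃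
    linarith

theorem Formula.val_deco (A : Formula V) (d : A.leaf.carrier → Atom W) : (A.deco d).val = A.val := by
  induction A with
  | atom x => rfl
  | par A B hA hB => exact congrArg₂ (· + ·) (hA _) (hB _)
  | tens A B hA hB => exact congrArg₂ (· + · - 2) (hA _) (hB _)

theorem map_val_seqDeco (Γ : List (Formula V)) (d : (seqLeaf Γ).carrier → Atom W) :
    (seqDeco Γ d).map Formula.val = Γ.map Formula.val := by
  induction Γ with
  | nil => rfl
  | cons A Γ ih => exact congrArg₂ List.cons (A.val_deco _) (ih _)

/-- An axiom has two leaves. A ⊗-rule adds the totals of its premises and subtracts 2 for the new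
tensor. -/
theorem Prov.sum_val {m : Multiset (Formula W)} (h : Prov m) : (m.map Formula.val).sum = 2 := by
  induction h with
  | id x => rfl
  | par _ ih => simpa [Formula.val, add_assoc] using ih
  | tens _ _ ih ih' =>
    simp only [Multiset.map_cons, Multiset.sum_cons, Multiset.map_add, Multiset.sum_add,
      Formula.val] at ih ih' ⊢
    linarith

end Correctness

/-! ### Nets with provable taggings are correct -/

section NetCorrectness

variable {V : Type u} {Γ : List (Formula V)}

/-- The atom `x` with its variable tagged by `t`. -/
def Atom.tag {T : Type} (x : Atom V) (t : T) : Atom (V × T) :=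
  match x with
  | .pos a => .pos (a, t)
  | .neg a => .neg (a, t)

/-- The tag of an atom. -/
def Atom.getTag {T : Type} : Atom (V × T) → T
  | .pos a => a.2
  | .neg a => a.2

theorem Atom.map_tag {T : Type} (x : Atom V) (t : T) : (x.tag t).map Prod.fst = x := by
  cases x <;> rfl

theorem Atom.getTag_tag {T : Type} (x : Atom V) (t : T) : (x.tag t).getTag = t := by
  cases x <;> rfl

theorem Atom.getTag_dual {T : Type} (x : Atom (V × T)) : x.dual.getTag = x.getTag := by
  cases x <;> rfl

theorem Atom.dual_tag {T : Type} (x : Atom V) (t : T) : x.dual.tag t = (x.tag t).dual := by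
  cases x <;> rfl

theorem Atom.ne_dual (x : Atom V) : x ≠ x.dual := by
  cases x <;> simp [Atom.dual]

/-- Being a variable. -/
def Atom.IsPos : Atom V → Prop
  | .pos _ => True
  | .neg _ => False

theorem Atom.isPos_dual (x : Atom V) : x.dual.IsPos ↔ ¬ x.IsPos := by
  cases x <;> simp [Atom.dual, Atom.IsPos]

/-- Each link joins a positive leaf to a negative one, so the positive leaves count the links. -/
theorem Linking.card_eq {X : OccSet V} [Finite X.carrier] (l : Linking X) :
    Nat.card X.carrier = 2 * Nat.card {x // (X.lab x).IsPos} := by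
  classical
  have e : {x // (X.lab x).IsPos} ≃ {x // ¬ (X.lab x).IsPos} :=
    { toFun := fun x => ⟨l.partner x, by rw [l.lab_partner, Atom.isPos_dual, not_not]; exact x.2⟩
      invFun := fun x => ⟨l.partner x, by rw [l.lab_partner, Atom.isPos_dual]; exact x.2⟩
      left_inv := fun x => Subtype.ext (l.partner_partner _)
      right_inv := fun x => Subtype.ext (l.partner_partner _) }
  rw [← Nat.card_congr (Equiv.sumCompl fun x => (X.lab x).IsPos), Nat.card_sum, ← Nat.card_congr e]
  ring

namespace PreNet

/-- The decoration of the leaves by tags that agree on linked leaves. -/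
theorem decor_tag {T : Type} (N : PreNet Γ)
    (t : ((seqLeaf Γ).sum (cutLeaf N.cut)).carrier → T) (ht : ∀ x, t (N.link.partner x) = t x) :
    N.Decor Prod.fst (fun x => ((seqLeaf Γ).lab x).tag (t (.inl x)))
      (fun i x => ((cutTree (N.cut i)).leaf.lab x).tag (t (.inr ⟨i, x⟩))) := by
  have key (x) : Sum.elim (fun x => ((seqLeaf Γ).lab x).tag (t (.inl x)))
      (fun p : (cutLeaf N.cut).carrier =>
        ((cutTree (N.cut p.1)).leaf.lab p.2).tag (t (.inr ⟨p.1, p.2⟩))) x =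
      (((seqLeaf Γ).sum (cutLeaf N.cut)).lab x).tag (t x) := by
    rcases x with x | x <;> rfl
  refine ⟨fun x => (congrArg _ (key x)).trans (Atom.map_tag _ _), fun x => ?_⟩
  refine (key _).trans (Eq.trans ?_ (congrArg Atom.dual (key x).symm))
  rw [N.link.lab_partner, ht, Atom.dual_tag]

theorem connected_of_prov (N : PreNet Γ) [Nonempty N.Node]
    (h : ∀ (T : Type) (d : (seqLeaf Γ).carrier → Atom (V × T))
      (c : (i : N.Cut) → (cutTree (N.cut i)).leaf.carrier → Atom (V × T)), N.Decor Prod.fst d c →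
      Prov ((seqDeco Γ d : Multiset (Formula (V × T))) + N.cutDeco c)) (s : N.Switching) :
    (N.switchingGraph s).Connected := by
  let g : N.Node → (N.switchingGraph s).ConnectedComponent :=
    (N.switchingGraph s).connectedComponentMk
  have hg (x y) (hxy : N.Edge s x y) : g x = g y := by
    -- The graph made from the edge relation omits loops.
    by_cases hne : x = y
    · rw [hne]
    · exact SimpleGraph.ConnectedComponent.connectedComponentMk_eq_of_adj
        ((SimpleGraph.fromRel_adj _ _ _).2 ⟨hne, .inl hxy⟩)
  -- Connected components are admissible tags because the ends of a link lie in the same component.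
  have hd := N.decor_tag (fun x => g (N.leafNode x)) fun x => (hg _ _ (.link x)).symm
  have hgs (x y) (hxy : SeqEdge Γ s.1 x y) : g (.inl x) = g (.inl y) := hg _ _ (.concl hxy)
  have hgc (i) (x y) (hxy : (cutTree (N.cut i)).Edge (s.2 i) x y) :
      g (.inr ⟨i, x⟩) = g (.inr ⟨i, y⟩) := hg _ _ (.cut i hxy)
  obtain ⟨q, hq⟩ := (h _ _ _ hd).exists_all_eq Atom.getTag Atom.getTag_dual fun A hA => by
    rcases Multiset.mem_add.1 hA with hA | hA
    · exact root_seqDeco Γ s.1 (fun x => g (.inl x)) _ hgs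
        (fun x => Atom.getTag_tag _ _) A hA
    · obtain ⟨i, rfl⟩ := mem_famDeco.1 hA
      exact ⟨_, Formula.root_deco _ (s.2 i) (fun x => g (.inr ⟨i, x⟩)) _ (hgc i)
        fun x => Atom.getTag_tag _ _⟩
  have hall (x : N.Node) : g x = q := by
    rcases x with x | ⟨i, x⟩
    · obtain ⟨y, hy⟩ := exists_seqLeaf Γ s.1 (fun x => g (.inl x)) hgs x
      refine hy.symm.trans ?_
      have := all_seqDeco (P := fun x => x.getTag = q) Γ _
        (fun A hA => hq A (Multiset.mem_add.2 (.inl hA))) y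
      exact (Atom.getTag_tag _ _).symm.trans this
    · obtain ⟨y, hy⟩ := Formula.exists_leaf _ (s.2 i) (fun x => g (.inr ⟨i, x⟩)) (hgc i) x
      refine hy.symm.trans ?_
      have := (Formula.all_deco _ _ _).1
        (hq _ (Multiset.mem_add.2 (.inr (mem_famDeco.2 ⟨i, rfl⟩)))) y
      exact (Atom.getTag_tag _ _).symm.trans this
  exact ⟨fun x y => SimpleGraph.ConnectedComponent.exact ((hall x).trans (hall y).symm)⟩

instance finite_node (N : PreNet Γ) : Finite N.Node :=
  inferInstanceAs (Finite (SeqNode Γ ⊕ ((i : N.Cut) × (cutTree (N.cut i)).Node)))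

/-- If the values of the conclusions and cuts of a net add up to 2, then its switchings have fewer
edges than nodes. -/
theorem card_edgeSet_add_one_le (N : PreNet Γ)
    (h : (Γ.map Formula.val).sum + (famDeco fun i => (cutTree (N.cut i)).val).sum = 2)
    (s : N.Switching) :
    Nat.card (N.switchingGraph s).edgeSet + 1 ≤ Nat.card N.Node := by
  let _ := Fintype.ofFinite N.Cut
  let leaf := ((seqLeaf Γ).sum (cutLeaf N.cut))
  have : Finite leaf.carrier := inferInstanceAs
    (Finite ((seqLeaf Γ).carrier ⊕ ((i : N.Cut) × (cutTree (N.cut i)).leaf.carrier)))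
  -- Each link is represented by its positive end and so counted once. Twice the number of links is
  -- the number of leaves, which is the leaf term in the bounds for tree edges.
  let E := (seqEdges Γ s.1 ⊕ ((i : N.Cut) × (cutTree (N.cut i)).edges (s.2 i))) ⊕
    {x // (leaf.lab x).IsPos}
  let f : E → Sym2 N.Node := fun e => match e with
    | .inl (.inl p) => s(.inl p.1.1, .inl p.1.2)
    | .inl (.inr ⟨i, p⟩) => s(.inr ⟨i, p.1.1⟩, .inr ⟨i, p.1.2⟩)
    | .inr x => s(N.leafNode x, N.leafNode (N.link.partner x))
  have hf (x y) (hxy : N.Edge s x y) : ∃ e, f e = s(x, y) := by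
    cases hxy with
    | concl h => exact ⟨.inl (.inl ⟨(_, _), h⟩), rfl⟩
    | cut i h => exact ⟨.inl (.inr ⟨i, (_, _), h⟩), rfl⟩
    | link x =>
      by_cases hx : (leaf.lab x).IsPos
      · exact ⟨.inr ⟨x, hx⟩, rfl⟩
      · refine ⟨.inr ⟨N.link.partner x, ?_⟩, ?_⟩
        · rw [N.link.lab_partner, Atom.isPos_dual]
          exact hx
        · exact (congrArg (fun z => s(_, N.leafNode z)) (N.link.partner_partner x)).trans Sym2.eq_swap
  have hsub : (N.switchingGraph s).edgeSet ⊆ Set.range f := by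
    intro e
    induction e with
    | _ x y =>
      intro he
      obtain ⟨-, h | h⟩ := (SimpleGraph.fromRel_adj _ _ _).1 ((SimpleGraph.mem_edgeSet _).1 he)
      · exact hf _ _ h
      · rw [Sym2.eq_swap]
        exact hf _ _ h
  have hE : Nat.card (N.switchingGraph s).edgeSet ≤ Nat.card E :=
    (Nat.card_mono (Set.toFinite _) hsub).trans (Finite.card_range_le f)
  have hcE : Nat.card E = (seqEdges Γ s.1).ncard + ∑ i, ((cutTree (N.cut i)).edges (s.2 i)).ncard +
      Nat.card {x // (leaf.lab x).IsPos} := by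
    simp only [E, Nat.card_sum, Nat.card_sigma, Nat.card_coe_set_eq]
  have hcN : Nat.card N.Node = Nat.card (SeqNode Γ) + ∑ i, Nat.card (cutTree (N.cut i)).Node := by
    refine (Nat.card_sum (α := SeqNode Γ)
      (β := (i : N.Cut) × (cutTree (N.cut i)).Node)).trans ?_
    rw [Nat.card_sigma]
  have hcl : Nat.card leaf.carrier = Nat.card (seqLeaf Γ).carrier +
      ∑ i, Nat.card (cutTree (N.cut i)).leaf.carrier := by
    refine (Nat.card_sum (α := (seqLeaf Γ).carrier)
      (β := (i : N.Cut) × (cutTree (N.cut i)).leaf.carrier)).trans ?_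
    rw [Nat.card_sigma]
  have hlink := N.link.card_eq
  have h₁ := two_mul_ncard_seqEdges_le Γ s.1
  have h₂ := Finset.sum_le_sum fun i (_ : i ∈ Finset.univ) =>
    (cutTree (N.cut i)).two_mul_ncard_edges_le (s.2 i)
  have h₃ : (famDeco fun i => (cutTree (N.cut i)).val).sum = ∑ i, (cutTree (N.cut i)).val := by
    rw [famDeco_eq]
    rfl
  rw [h₃] at h
  simp only [Finset.sum_add_distrib, ← Finset.mul_sum] at h₂
  zify at hE hcE hcN hcl hlink ⊢
  linarith

/-- A net whose decorations are all provable is correct. -/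
theorem correct_of_prov (N : PreNet Γ)
    (h : ∀ (T : Type) (d : (seqLeaf Γ).carrier → Atom (V × T))
      (c : (i : N.Cut) → (cutTree (N.cut i)).leaf.carrier → Atom (V × T)), N.Decor Prod.fst d c →
      Prov ((seqDeco Γ d : Multiset (Formula (V × T))) + N.cutDeco c)) : N.Correct := by
  intro s
  -- Values ignore tags, so the constant tagging suffices to evaluate their sum.
  have hcard := N.card_edgeSet_add_one_le (by
    have := (h _ _ _ (N.decor_tag (fun _ => ()) fun _ => rfl)).sum_val
    rw [Multiset.map_add, Multiset.sum_add, Multiset.map_coe, Multiset.sum_coe,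
      map_val_seqDeco] at this
    rw [← this]
    congr 2
    let _ := Fintype.ofFinite N.Cut
    rw [cutDeco, famDeco_eq, famDeco_eq, Multiset.map_map]
    congr 1
    funext i
    exact (Formula.val_deco _ _).symm) s
  have : Nonempty N.Node := (Nat.card_pos_iff.1 (by omega)).1
  have hconn := N.connected_of_prov h s
  -- A connected graph has at least one edge fewer than nodes; with the opposite bound it is a tree.
  exact ⟨hconn, (SimpleGraph.isTree_iff_connected_and_card.2
    ⟨hconn, le_antisymm hcard hconn.card_vert_le_card_edgeSet_add_one⟩).isAcyclic⟩

end PreNet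

theorem SeqProof.correct (p : SeqProof Γ) : p.net.Correct :=
  p.net.correct_of_prov fun _ d c h => p.prov d c h

theorem CosProof.correct {F : Formula V} (q : CosProof (some F)) : q.net.Correct :=
  PreNet.correct_of_prov (Γ := [F]) q.net fun _ d c h => q.prov _ d c h

end NetCorrectness

/-! ### Comparing the two calculi -/

section Comparison

variable {V : Type u} {W : Type v}

theorem ParOf.parM {Γ : List (Formula V)} {F : Formula V} (b : ParOf Γ F)
    (d : F.leaf.carrier → Atom W) :
    ParM (seqDeco Γ fun x => d (b.flow.equiv x)) (F.deco d) := by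
  induction b with
  | single A => exact .single _
  | @par Γ Δ F G b c ihb ihc =>
    have := (ihb fun x => d (.inl x)).par (ihc fun x => d (.inr x))
    rw [Multiset.coe_add] at this
    have e := seqDeco_append' Γ Δ fun z => d (Sum.map b.flow.equiv c.flow.equiv z)
    exact e ▸ this

/-- Invertibility of ⅋ opens the ⅋s that join the conclusions, and no others. -/
theorem Prov.of_parM {Γ : Multiset (Formula W)} {F : Formula W} (h : ParM Γ F) :
    ∀ {Δ : Multiset (Formula W)}, Prov (F ::ₘ Δ) → Prov (Γ + Δ) := by
  induction h with
  | single A => exact fun h => h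
  | @par Γ₁ Γ₂ F G _ _ ih ih' =>
    intro Δ h
    have := ih h.par_inv
    rw [Multiset.add_cons] at this
    refine (ih' this).cast ?_
    abel

theorem PreNet.Decor.isCut {π : W → V} {Γ : List (Formula V)} {N : PreNet Γ}
    {d : (seqLeaf Γ).carrier → Atom W} {c} (h : N.Decor π d c) :
    ∀ A ∈ N.cutDeco c, IsCut π A := by
  intro A hA
  obtain ⟨i, rfl⟩ := mem_famDeco.1 hA
  obtain ⟨h₁, h₂⟩ := Formula.tens.inj (h.map_cutTree i)
  exact ⟨_, _, rfl, h₂.trans (congrArg Formula.dual h₁.symm)⟩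

/-- A decoration that tells the leaves of a net apart. -/
theorem PreNet.exists_injective_decor {Γ : List (Formula V)} (N : PreNet Γ) :
    ∃ (T : Type) (d : (seqLeaf Γ).carrier → Atom (V × T)) (c : (i : N.Cut) → _),
      N.Decor Prod.fst d c ∧
      Function.Injective (Sum.elim d fun p : (cutLeaf N.cut).carrier => c p.1 p.2) := by
  -- The tag of a leaf is its link as an unordered pair. Only the two ends of a link share a tag,
  -- and these are told apart by their dual labels.
  let t (x) : Set ((seqLeaf Γ).sum (cutLeaf N.cut)).carrier := {x, N.link.partner x}
  have ht (x) : t (N.link.partner x) = t x := by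
    simp only [t, N.link.partner_partner, Set.pair_comm]
  have hd := N.decor_tag t ht
  have htag (x) : (Sum.elim (fun x => ((seqLeaf Γ).lab x).tag (t (.inl x)))
      (fun p : (cutLeaf N.cut).carrier =>
        ((cutTree (N.cut p.1)).leaf.lab p.2).tag (t (.inr ⟨p.1, p.2⟩))) x).getTag = t x := by
    rcases x with x | x <;> exact Atom.getTag_tag _ _
  refine ⟨_, _, _, hd, fun x y hxy => ?_⟩
  have hlab := (hd.1 x).symm.trans ((congrArg (Atom.map Prod.fst) hxy).trans (hd.1 y))
  have hmem : x ∈ t y := by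
    rw [← htag y, ← hxy, htag x]
    exact .inl rfl
  rcases hmem with h | h
  · exact h
  · have h' := N.link.lab_partner y
    rw [← show x = N.link.partner y from h, hlab] at h'
    exact absurd h' (Atom.ne_dual _)

/-- The same decoration on the net with the conclusions joined. -/
theorem PreNet.Decor.parConclusions {π : W → V} {Γ : List (Formula V)} {F : Formula V}
    {N : PreNet Γ} (b : ParOf Γ F) {d : (seqLeaf [F]).carrier → Atom W} {c}
    (h : N.Decor π (fun x => d (.inl (b.flow.equiv x))) c) : (N.parConclusions b).Decor π d c :=
  (decor_flow _ _ _ _).2 h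

/-- An injective tagging of the net is carried through `Prov` to the calculus of structures. The
resulting net has the same tagged conclusion and cuts, hence it is the same net. -/
theorem SeqProof.exists_cosProof {Γ : List (Formula V)} {F : Formula V} (p : SeqProof Γ)
    (b : ParOf Γ F) : ∃ q : CosProof (some F), (p.net.parConclusions b).Same q.net := by
  obtain ⟨T, d, c, hd, hinj⟩ := (p.net.parConclusions b).exists_injective_decor
  have hd' : p.net.Decor Prod.fst (fun x => d (.inl (b.flow.equiv x))) c :=
    (PreNet.decor_flow _ _ _ _).1 hd
  have hprov := p.prov _ _ hd'
  have hF := b.parM fun x => d (.inl x)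
  have hcos : DCos Prod.fst (F.deco fun x => d (.inl x)) (p.net.cutDeco c + 0) :=
    DCos.cuts (p.net.cutDeco c) hd'.isCut hF (hprov.dcos Prod.fst)
  rw [add_zero] at hcos
  obtain ⟨q, d', c', hq, hqF, hqC⟩ := hcos.realCos.exists_of_eq
    (F.map_deco Prod.fst _ fun x => hd.1 (.inl (.inl x)))
  have hdd : d' = d := by
    funext x
    rcases x with x | x
    · exact congrFun (F.deco_injective hqF) x
    · exact x.elim
  subst hdd
  exact ⟨q, PreNet.same_of_decor Prod.fst hd hq hqC.symm (.inl hinj)⟩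

/-- The same passage backwards: after the joining ⅋s are opened, the derivation is read as a sequent
proof with the tagged cuts restored. -/
theorem CosProof.exists_seqProof {Γ : List (Formula V)} {F : Formula V} (q : CosProof (some F))
    (b : ParOf Γ F) : ∃ p : SeqProof Γ, (p.net.parConclusions b).Same q.net := by
  obtain ⟨T, d, c, hd, hinj⟩ := PreNet.exists_injective_decor (Γ := [F]) q.net
  have hprov := (q.prov _ d c hd).of_parM (b.parM fun x => d (.inl x))
  have hreal := hprov.realSeq _ _ rfl hd.isCut
  obtain ⟨p, d', c', hp, hpΓ, hpC⟩ := hreal.exists_of_eq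
    (map_seqDeco Prod.fst Γ _ fun x => (hd.1 (.inl (.inl (b.flow.equiv x)))).trans
      (b.flow.lab_eq x))
  obtain rfl := seqDeco_injective Γ hpΓ
  exact ⟨p, PreNet.same_of_decor Prod.fst (PreNet.Decor.parConclusions b hp) hd hpC (.inr hinj)⟩

end Comparison

end MLL

theorem mainTheorem3 {V : Type*} (Γ : List (MLL.Formula V)) (F : MLL.Formula V)
    (b : MLL.ParOf Γ F) :
    (∀ p : MLL.SeqProof Γ, ∃ q : MLL.CosProof (some F), MLL.SameProofNet b p.net q.net) ∧
    (∀ q : MLL.CosProof (some F), ∃ p : MLL.SeqProof Γ, MLL.SameProofNet b p.net q.net) := by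
  constructor
  · intro p
    obtain ⟨q, h⟩ := p.exists_cosProof b
    exact ⟨q, p.correct, q.correct, h⟩
  · intro q
    obtain ⟨p, h⟩ := q.exists_seqProof b
    exact ⟨p, p.correct, q.correct, h⟩
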